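/- Let $(\widetilde M, g, J)$ be a Kähler manifold of real dimension $2m$ with Levi-Civita connection $\widetilde\nabla$ (so $J^2=-1$, $g(JX,JY)=g(X,Y)$, $\widetilde\nabla J=0$), and let $M$ be an $n$-dimensional ($n>1$) smooth immersed submanifold of $\widetilde M$ with the induced metric. Let $\sigma$ be the second fundamental form of $M$ (the normal component of $\widetilde\nabla_XY$), $H=\frac1n\operatorname{tr}\sigma$ its mean curvature vector, $D$ the normal connection (the normal component of $\widetilde\nabla_X\xi$), $R^\perp(X,Y)\xi=D_XD_Y\xi-D_YD_X\xi-D_{[X,Y]}\xi$ its curvature tensor, and let $f\xi$ denote the normal component of $J\xi$ for normal vector fields $\xi$. Assume that 1. $M$ is totally real: $J\,T_pM\subset (T_pM)^\perp$ for every $p\in M$; 2. the $f$-structure in the normal bundle is parallel: $D_X(f\xi)=f(D_X\xi)$ for all smooth tangent vector fields $X$ and all smooth normal vector fields $\xi$ of $M$ (in particular $f=0$ is allowed); 3. $M$ has constant sectional curvature $c$ for some constant $c\in\mathbb R$; 4. the mean curvature vector is semiparallel: $R^\perp(X,Y)H=0$ for all smooth tangent vector fields $X,Y$ of $M$. Then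 $M$ is minimal ($H=0$ everywhere) or flat (its sectional curvature vanishes identically). -/

import Mathlib

open Bundle VectorField Module
open scoped Manifold ContDiff

set_option linter.unusedSectionVars false

noncomputable section

namespace TotallyReal

section LeviCivita

variable {E : Type*} [NormedAddCommGroup E] [NormedSpace ℝ E] [FiniteDimensional ℝ E] [CompleteSpace E]
  {M : Type*} [TopologicalSpace M] [ChartedSpace E M] [IsManifold 𝓘(ℝ, E) ∞ M]
  [RiemannianBundle (fun x : M ↦ TangentSpace 𝓘(ℝ, E) x)]
  [IsContMDiffRiemannianBundle 𝓘(ℝ, E) ∞ E (fun x : M ↦ TangentSpace 𝓘(ℝ, E) x)]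

/-- The function `x ↦ g(X, Y)(x)` for two vector fields on a Riemannian manifold. -/
def metric (X Y : Π x : M, TangentSpace 𝓘(ℝ, E) x) (x : M) : ℝ := inner ℝ (X x) (Y x)

/-- The right-hand side of the Koszul formula for `2 g(∇_X Y, Z)`:
`X g(Y,Z) + Y g(Z,X) - Z g(X,Y) - g(Y,[X,Z]) - g(Z,[Y,X]) + g(X,[Z,Y])`. -/
def koszul (Y X Z : Π x : M, TangentSpace 𝓘(ℝ, E) x) (x : M) : ℝ :=
  mvfderiv 𝓘(ℝ, E) (metric Y Z) x (X x) + mvfderiv 𝓘(ℝ, E) (metric Z X) x (Y x)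
    - mvfderiv 𝓘(ℝ, E) (metric X Y) x (Z x)
    - inner ℝ (Y x) (mlieBracket 𝓘(ℝ, E) X Z x) - inner ℝ (Z x) (mlieBracket 𝓘(ℝ, E) Y X x)
    + inner ℝ (X x) (mlieBracket 𝓘(ℝ, E) Z Y x)

variable {x : M} {X Y Z : Π x : M, TangentSpace 𝓘(ℝ, E) x}
lemma mdiffAt_metric (hX : MDiffAt (T% X) x) (hY : MDiffAt (T% Y) x) :
    MDiffAt (metric X Y) x := MDifferentiableAt.inner_bundle hX hY

lemma koszul_tensorial_left (hY : MDiffAt (T% Y) x) (hZ : MDiffAt (T% Z) x) :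
    TensorialAt 𝓘(ℝ, E) E (fun X => koszul Y X Z x) x where
  smul {f X} hf hX := by
    have h1 : metric Z (f • X) = f * metric Z X := by
      ext y; simp [metric, inner_smul_right]
    have h2 : metric (f • X) Y = f * metric X Y := by
      ext y; simp [metric, inner_smul_left]
    simp only [koszul, h1, h2]
    rw [mvfderiv_mul hf (mdiffAt_metric hZ hX), mvfderiv_mul hf (mdiffAt_metric hX hY),
      mlieBracket_smul_left hf hX, mlieBracket_smul_right hf hX]
    simp [inner_smul_right, inner_smul_left, inner_add_right, metric]
    rw [real_inner_comm (Y x) (X x)]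
    ring
  add {X X'} hX hX' := by
    have h1 : metric Z (X + X') = metric Z X + metric Z X' := by
      ext y; simp [metric, inner_add_right]
    have h2 : metric (X + X') Y = metric X Y + metric X' Y := by
      ext y; simp [metric, inner_add_left]
    simp only [koszul, h1, h2]
    rw [mvfderiv_add (mdiffAt_metric hZ hX) (mdiffAt_metric hZ hX'), mvfderiv_add (mdiffAt_metric hX hY) (mdiffAt_metric hX' hY),
      mlieBracket_add_left hX hX', mlieBracket_add_right hX hX']
    simp [inner_add_right, inner_add_left]
    ring

lemma koszul_tensorial_right (hY : MDiffAt (T% Y) x) (hX : MDiffAt (T% X) x) :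
    TensorialAt 𝓘(ℝ, E) E (fun Z => koszul Y X Z x) x where
  smul {f Z} hf hZ := by
    have h1 : metric Y (f • Z) = f * metric Y Z := by
      ext y; simp [metric, inner_smul_right]
    have h2 : metric (f • Z) X = f * metric Z X := by
      ext y; simp [metric, inner_smul_left]
    simp only [koszul, h1, h2]
    rw [mvfderiv_mul hf (mdiffAt_metric hY hZ), mvfderiv_mul hf (mdiffAt_metric hZ hX),
      mlieBracket_smul_left hf hZ, mlieBracket_smul_right hf hZ]
    simp [inner_smul_right, inner_smul_left, inner_add_right, metric]
    rw [real_inner_comm (X x) (Z x)]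
    ring
  add {Z Z'} hZ hZ' := by
    have h1 : metric Y (Z + Z') = metric Y Z + metric Y Z' := by
      ext y; simp [metric, inner_add_right]
    have h2 : metric (Z + Z') X = metric Z X + metric Z' X := by
      ext y; simp [metric, inner_add_left]
    simp only [koszul, h1, h2]
    rw [mvfderiv_add (mdiffAt_metric hY hZ) (mdiffAt_metric hY hZ'),
      mvfderiv_add (mdiffAt_metric hZ hX) (mdiffAt_metric hZ' hX),
      mlieBracket_add_left hZ hZ', mlieBracket_add_right hZ hZ']
    simp [inner_add_right, inner_add_left]
    ring

lemma koszul_add {Y' : Π x : M, TangentSpace 𝓘(ℝ, E) x} (hX : MDiffAt (T% X) x)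
    (hZ : MDiffAt (T% Z) x) (hY : MDiffAt (T% Y) x) (hY' : MDiffAt (T% Y') x) :
    koszul (Y + Y') X Z x = koszul Y X Z x + koszul Y' X Z x := by
  have h1 : metric (Y + Y') Z = metric Y Z + metric Y' Z := by
    ext y; simp [metric, inner_add_left]
  have h2 : metric X (Y + Y') = metric X Y + metric X Y' := by
    ext y; simp [metric, inner_add_right]
  simp only [koszul, h1, h2]
  rw [mvfderiv_add (mdiffAt_metric hY hZ) (mdiffAt_metric hY' hZ),
    mvfderiv_add (mdiffAt_metric hX hY) (mdiffAt_metric hX hY'),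
    mlieBracket_add_left hY hY', mlieBracket_add_right hY hY']
  simp [inner_add_right, inner_add_left]
  ring

lemma koszul_smul {f : M → ℝ} (hX : MDiffAt (T% X) x)
    (hZ : MDiffAt (T% Z) x) (hf : MDiffAt f x) (hY : MDiffAt (T% Y) x) :
    koszul (f • Y) X Z x = f x * koszul Y X Z x
      + 2 * (mvfderiv 𝓘(ℝ, E) f x (X x) * inner ℝ (Y x) (Z x)) := by
  have h1 : metric (f • Y) Z = f * metric Y Z := by
    ext y; simp [metric, inner_smul_left]
  have h2 : metric X (f • Y) = f * metric X Y := by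
    ext y; simp [metric, inner_smul_right]
  simp only [koszul, h1, h2]
  rw [mvfderiv_mul hf (mdiffAt_metric hY hZ), mvfderiv_mul hf (mdiffAt_metric hX hY),
    mlieBracket_smul_left hf hY, mlieBracket_smul_right hf hY]
  simp [inner_smul_right, inner_smul_left, inner_add_right, metric]
  rw [real_inner_comm (Y x) (Z x)]
  ring

instance (x : M) : FiniteDimensional ℝ (TangentSpace 𝓘(ℝ, E) x) :=
  inferInstanceAs (FiniteDimensional ℝ E)

open Classical in
/-- The Levi-Civita connection as a function: `∇_X Y` at `x` is the vector `w` of `T_x M` such that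
`2 g(w, Z x)` is the Koszul expression (junk value `0` where `Y` is not differentiable). Mathlib's
argument order: `leviCivitaFun Y x v` is `∇_v Y`. -/
def leviCivitaFun (Y : Π x : M, TangentSpace 𝓘(ℝ, E) x) (x : M) :
    TangentSpace 𝓘(ℝ, E) x →L[ℝ] TangentSpace 𝓘(ℝ, E) x :=
  if hY : MDiffAt (T% Y) x then
    LinearMap.toContinuousLinearMap
      { toFun := fun v ↦ (1 / 2 : ℝ) •
          (InnerProductSpace.toDual ℝ (TangentSpace 𝓘(ℝ, E) x)).symm
            (TensorialAt.mkHom₂ (fun X Z ↦ koszul Y X Z x) x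
              (fun _ hZ ↦ koszul_tensorial_left hY hZ) (fun _ hX ↦ koszul_tensorial_right hY hX) v)
        map_add' := fun v w ↦ by simp
        map_smul' := fun c v ↦ by simp [smul_comm c] }
  else 0

lemma inner_leviCivitaFun (hX : MDiffAt (T% X) x) (hY : MDiffAt (T% Y) x) (hZ : MDiffAt (T% Z) x) :
    inner ℝ (leviCivitaFun Y x (X x)) (Z x) = 1 / 2 * koszul Y X Z x := by
  rw [leviCivitaFun, dif_pos hY]
  simp [inner_smul_left, TensorialAt.mkHom₂_apply _ _ hX hZ]


lemma eq_of_inner {v w : TangentSpace 𝓘(ℝ, E) x}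
    (h : ∀ z : TangentSpace 𝓘(ℝ, E) x, inner ℝ v z = inner ℝ w z) : v = w :=
  ext_inner_right ℝ h

lemma leviCivitaFun_isCov : IsCovariantDerivativeOn (I := 𝓘(ℝ, E)) (M := M) E
    (V := fun x : M ↦ TangentSpace 𝓘(ℝ, E) x) leviCivitaFun Set.univ where
  add {Y Y' x} hY hY' _ := by
    ext v
    refine eq_of_inner fun z ↦ ?_
    have hX := FiberBundle.mdifferentiableAt_extend 𝓘(ℝ, E) E v
    have hZ := FiberBundle.mdifferentiableAt_extend 𝓘(ℝ, E) E z
    have h := inner_leviCivitaFun hX (mdifferentiableAt_add_section hY hY') hZ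
    have h1 := inner_leviCivitaFun hX hY hZ
    have h2 := inner_leviCivitaFun hX hY' hZ
    rw [koszul_add hX hZ hY hY'] at h
    simp only [FiberBundle.extend_apply_self] at h h1 h2
    rw [h, add_apply, inner_add_left, h1, h2]
    ring
  leibniz {Y f x} hY hf _ := by
    ext v
    refine eq_of_inner fun z ↦ ?_
    have hX := FiberBundle.mdifferentiableAt_extend 𝓘(ℝ, E) E v
    have hZ := FiberBundle.mdifferentiableAt_extend 𝓘(ℝ, E) E z
    have h := inner_leviCivitaFun hX (hf.smul_section hY) hZ
    have h1 := inner_leviCivitaFun hX hY hZ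
    rw [koszul_smul hX hZ hf hY] at h
    simp only [FiberBundle.extend_apply_self] at h h1
    rw [h]
    simp [inner_add_left, inner_smul_left, h1]
    ring

variable (E M) in
/-- The Levi-Civita connection of a Riemannian manifold `M`; `leviCivita E M Y x v` is `∇_v Y`. -/
def leviCivita : CovariantDerivative 𝓘(ℝ, E) E (fun x : M ↦ TangentSpace 𝓘(ℝ, E) x) where
  toFun := leviCivitaFun
  isCovariantDerivativeOnUniv := leviCivitaFun_isCov

/-- The Levi-Civita connection is torsion free. -/
theorem leviCivita_torsion : (leviCivita E M).torsion = 0 := by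
  rw [CovariantDerivative.torsion_eq_zero_iff]
  intro X Y x hX hY
  refine eq_of_inner fun z ↦ ?_
  have hZ := FiberBundle.mdifferentiableAt_extend 𝓘(ℝ, E) E z
  have h1 := inner_leviCivitaFun hX hY hZ
  have h2 := inner_leviCivitaFun hY hX hZ
  simp only [FiberBundle.extend_apply_self] at h1 h2
  rw [inner_sub_left]
  erw [h1, h2]
  have hs : ∀ A B : Π x : M, TangentSpace 𝓘(ℝ, E) x, metric A B = metric B A := by
    intro A B; ext y; exact real_inner_comm _ _
  set Z := FiberBundle.extend E z
  have hz : Z x = z := by simp [Z]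
  simp only [koszul]
  rw [hs Y Z, hs Z X, hs X Y, mlieBracket_swap_apply (V := Y) (W := X),
    mlieBracket_swap_apply (V := Z) (W := Y), mlieBracket_swap_apply (V := Z) (W := X), hz,
    real_inner_comm z]
  simp
  ring

/-- The Levi-Civita connection is compatible with the metric. -/
theorem leviCivita_metric (hY : MDiffAt (T% Y) x) (hZ : MDiffAt (T% Z) x)
    (v : TangentSpace 𝓘(ℝ, E) x) :
    mvfderiv 𝓘(ℝ, E) (fun y ↦ inner ℝ (Y y) (Z y)) x v =
      inner ℝ (leviCivita E M Y x v) (Z x) + inner ℝ (Y x) (leviCivita E M Z x v) := by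
  have hX := FiberBundle.mdifferentiableAt_extend 𝓘(ℝ, E) E v
  have h1 := inner_leviCivitaFun hX hY hZ
  have h2 := inner_leviCivitaFun hX hZ hY
  have hv : FiberBundle.extend E v x = v := by simp
  set X := FiberBundle.extend E v
  change mvfderiv 𝓘(ℝ, E) (metric Y Z) x v = inner ℝ (leviCivitaFun Y x v) (Z x) +
    inner ℝ (Y x) (leviCivitaFun Z x v)
  rw [← hv, real_inner_comm (leviCivitaFun Z x (X x)), h1, h2]
  have hs : ∀ A B : Π x : M, TangentSpace 𝓘(ℝ, E) x, metric A B = metric B A := by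
    intro A B; ext y; exact real_inner_comm _ _
  simp only [koszul]
  rw [hs Y Z, hs Z X, hs X Y, mlieBracket_swap_apply (V := Y) (W := X),
    mlieBracket_swap_apply (V := Z) (W := Y), mlieBracket_swap_apply (V := Z) (W := X)]
  simp
  ring

/-- `X` is a smooth vector field on `M`, i.e. `X ∈ 𝔛(M)`. -/
def IsSmoothField (X : Π x : M, TangentSpace 𝓘(ℝ, E) x) : Prop :=
  ContMDiff 𝓘(ℝ, E) 𝓘(ℝ, E).tangent ∞ (T% X)

/-- The curvature tensor `R(X,Y)Z = ∇_X ∇_Y Z - ∇_Y ∇_X Z - ∇_{[X,Y]} Z` at `x`. -/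
def curvature (X Y Z : Π x : M, TangentSpace 𝓘(ℝ, E) x) (x : M) : TangentSpace 𝓘(ℝ, E) x :=
  leviCivita E M (fun y ↦ leviCivita E M Z y (Y y)) x (X x)
    - leviCivita E M (fun y ↦ leviCivita E M Z y (X y)) x (Y x)
    - leviCivita E M Z x (mlieBracket 𝓘(ℝ, E) X Y x)

variable (E M) in
/-- `M` has constant (sectional) curvature `c`: for every point and every pair of tangent vectors
there, given as the values of smooth vector fields,
`g(R(X,Y)Y, X) = c (g(X,X) g(Y,Y) - g(X,Y)²)`. -/
def HasConstantCurvature (c : ℝ) : Prop :=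
  ∀ X Y : Π x : M, TangentSpace 𝓘(ℝ, E) x, IsSmoothField X → IsSmoothField Y →
    ∀ x : M, inner ℝ (curvature X Y Y x) (X x) =
      c * (inner ℝ (X x) (X x) * inner ℝ (Y x) (Y x) - inner ℝ (X x) (Y x) ^ 2)

variable (E M) in
/-- `M` is flat: its sectional curvature vanishes identically. -/
def IsFlat : Prop := HasConstantCurvature E M 0

/-- `J` is a Kähler structure on the Riemannian manifold `M`: a smooth almost complex structure
which is orthogonal and parallel for the Levi-Civita connection (hence integrable, with closed
fundamental form). -/
structure IsKaehler (J : Π x : M, TangentSpace 𝓘(ℝ, E) x →L[ℝ] TangentSpace 𝓘(ℝ, E) x) :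
    Prop where
  smooth : ContMDiff 𝓘(ℝ, E) (𝓘(ℝ, E).prod 𝓘(ℝ, E →L[ℝ] E)) ∞
    (fun x ↦ TotalSpace.mk' (E →L[ℝ] E)
      (E := fun x : M ↦ TangentSpace 𝓘(ℝ, E) x →L[ℝ] TangentSpace 𝓘(ℝ, E) x) x (J x))
  sq (x : M) (v : TangentSpace 𝓘(ℝ, E) x) : J x (J x v) = -v
  isometric (x : M) (v w : TangentSpace 𝓘(ℝ, E) x) : inner ℝ (J x v) (J x w) = inner ℝ v w
  parallel (Y : Π x : M, TangentSpace 𝓘(ℝ, E) x) (x : M) (hY : MDiffAt (T% Y) x)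
    (v : TangentSpace 𝓘(ℝ, E) x) :
    leviCivita E M (fun y ↦ J y (Y y)) x v = J x (leviCivita E M Y x v)

end LeviCivita

section Submanifold

variable {E : Type*} [NormedAddCommGroup E] [NormedSpace ℝ E] [FiniteDimensional ℝ E]
  [CompleteSpace E]
  {M : Type*} [TopologicalSpace M] [ChartedSpace E M] [IsManifold 𝓘(ℝ, E) ∞ M]
  [RiemannianBundle (fun x : M ↦ TangentSpace 𝓘(ℝ, E) x)]
  [IsContMDiffRiemannianBundle 𝓘(ℝ, E) ∞ E (fun x : M ↦ TangentSpace 𝓘(ℝ, E) x)]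
  {F : Type*} [NormedAddCommGroup F] [NormedSpace ℝ F] [FiniteDimensional ℝ F]
  [CompleteSpace F]
  {N : Type*} [TopologicalSpace N] [ChartedSpace F N] [IsManifold 𝓘(ℝ, F) ∞ N]
  [RiemannianBundle (fun x : N ↦ TangentSpace 𝓘(ℝ, F) x)]
  [IsContMDiffRiemannianBundle 𝓘(ℝ, F) ∞ F (fun x : N ↦ TangentSpace 𝓘(ℝ, F) x)]

variable (E F) in
/-- `ι : M → N` makes `M` an (immersed) Riemannian submanifold of `N`: it is smooth and the metric
of `M` is the one induced by `ι`. In particular each `dι_p` is injective. -/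
structure IsIsometricImmersion (ι : M → N) : Prop where
  smooth : ContMDiff 𝓘(ℝ, E) 𝓘(ℝ, F) ∞ ι
  isometric (p : M) (v w : TangentSpace 𝓘(ℝ, E) p) :
    inner ℝ (mfderiv 𝓘(ℝ, E) 𝓘(ℝ, F) ι p v) (mfderiv 𝓘(ℝ, E) 𝓘(ℝ, F) ι p w) = inner ℝ v w

/-- The covariant derivative `∇̃_v V` of a vector field `V` of `N` along `ι : M → N`, with `v ∈ T_p M`
(the connection induced on `ι^* TN` by the Levi-Civita connection of `N`). In the local
trivialization of `TN` at `ι p`, the field `V` has principal part `W : M → F`; the vector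
`∇̃_v V` has principal part `dW(v) + Γ(dι v, W p)`, where `Γ(dι v, W p)` is the derivative in
direction `dι v` of the vector field on `N` with constant principal part `W p`. -/
def covAlong (ι : M → N) (V : Π p : M, TangentSpace 𝓘(ℝ, F) (ι p)) (p : M)
    (v : TangentSpace 𝓘(ℝ, E) p) : TangentSpace 𝓘(ℝ, F) (ι p) :=
  let e := trivializationAt F (fun x : N ↦ TangentSpace 𝓘(ℝ, F) x) (ι p)
  let W : M → F := fun q ↦ (e ⟨ι q, V q⟩).2
  e.symm (ι p) (mvfderiv 𝓘(ℝ, E) W p v) +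
    leviCivita F N (FiberBundle.extend F (V p)) (ι p) (mfderiv 𝓘(ℝ, E) 𝓘(ℝ, F) ι p v)

variable (E) in
/-- `T_p M` as a subspace of `T_{ι p} N`. -/
def tangentImage (ι : M → N) (p : M) : Submodule ℝ (TangentSpace 𝓘(ℝ, F) (ι p)) :=
  LinearMap.range
    (mfderiv 𝓘(ℝ, E) 𝓘(ℝ, F) ι p : TangentSpace 𝓘(ℝ, E) p →ₗ[ℝ] TangentSpace 𝓘(ℝ, F) (ι p))

variable (E) in
/-- The normal component of a vector of `T_{ι p} N`. -/
def normalPart (ι : M → N) (p : M) (v : TangentSpace 𝓘(ℝ, F) (ι p)) :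
    TangentSpace 𝓘(ℝ, F) (ι p) :=
  (tangentImage E ι p)ᗮ.starProjection v

variable (E) in
/-- `ξ` is a smooth normal vector field, i.e. `ξ ∈ 𝔛(M)^⊥`. -/
structure IsSmoothNormalField (ι : M → N) (ξ : Π p : M, TangentSpace 𝓘(ℝ, F) (ι p)) : Prop where
  smooth : ContMDiff 𝓘(ℝ, E) 𝓘(ℝ, F).tangent ∞
    (fun p ↦ (⟨ι p, ξ p⟩ : TangentBundle 𝓘(ℝ, F) N))
  normal (p : M) : ξ p ∈ (tangentImage E ι p)ᗮ

/-- The normal connection `D_X ξ`, the normal component of `∇̃_X ξ`. -/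
def normalCov (ι : M → N) (X : Π p : M, TangentSpace 𝓘(ℝ, E) p)
    (ξ : Π p : M, TangentSpace 𝓘(ℝ, F) (ι p)) (p : M) : TangentSpace 𝓘(ℝ, F) (ι p) :=
  normalPart E ι p (covAlong ι ξ p (X p))

/-- The curvature of the normal connection,
`R^⊥(X,Y)ξ = D_X D_Y ξ - D_Y D_X ξ - D_{[X,Y]} ξ`. -/
def normalCurvature (ι : M → N) (X Y : Π p : M, TangentSpace 𝓘(ℝ, E) p)
    (ξ : Π p : M, TangentSpace 𝓘(ℝ, F) (ι p)) (p : M) : TangentSpace 𝓘(ℝ, F) (ι p) :=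
  normalCov ι X (normalCov ι Y ξ) p - normalCov ι Y (normalCov ι X ξ) p
    - normalCov ι (mlieBracket 𝓘(ℝ, E) X Y) ξ p

/-- The second fundamental form `σ(X,Y)`, the normal component of `∇̃_X Y`. -/
def secondFundamentalForm (ι : M → N) (X Y : Π p : M, TangentSpace 𝓘(ℝ, E) p) (p : M) :
    TangentSpace 𝓘(ℝ, F) (ι p) :=
  normalPart E ι p (covAlong ι (fun q ↦ mfderiv 𝓘(ℝ, E) 𝓘(ℝ, F) ι q (Y q)) p (X p))

variable (E F) in
/-- The mean curvature vector `H = (1/n) tr σ`: the trace is taken with respect to an orthonormal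
basis of `T_p M`, whose vectors are extended to vector fields to evaluate the tensor `σ`. -/
def meanCurvature (ι : M → N) (p : M) : TangentSpace 𝓘(ℝ, F) (ι p) :=
  (finrank ℝ E : ℝ)⁻¹ • ∑ i, secondFundamentalForm ι
    (FiberBundle.extend E (stdOrthonormalBasis ℝ (TangentSpace 𝓘(ℝ, E) p) i))
    (FiberBundle.extend E (stdOrthonormalBasis ℝ (TangentSpace 𝓘(ℝ, E) p) i)) p

variable (E F) in
/-- `M` is minimal: `H = 0`. -/
def IsMinimal (ι : M → N) : Prop := ∀ p : M, meanCurvature E F ι p = 0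

variable (E F) in
/-- The mean curvature vector is semiparallel: `R^⊥(X,Y)H = 0`. -/
def HasSemiparallelMeanCurvature (ι : M → N) : Prop :=
  ∀ X Y : Π p : M, TangentSpace 𝓘(ℝ, E) p, IsSmoothField X → IsSmoothField Y →
    ∀ p : M, normalCurvature ι X Y (meanCurvature E F ι) p = 0

variable (E) in
/-- `M` is totally real: `J T_p M ⊆ (T_p M)^⊥` for all `p`. -/
def IsTotallyReal (ι : M → N)
    (J : Π x : N, TangentSpace 𝓘(ℝ, F) x →L[ℝ] TangentSpace 𝓘(ℝ, F) x) : Prop :=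
  ∀ (p : M), ∀ v ∈ tangentImage E ι p, J (ι p) v ∈ (tangentImage E ι p)ᗮ

variable (E) in
/-- The endomorphism `f` of the normal bundle: `f ξ` is the normal component of `J ξ`. -/
def fStructure (ι : M → N)
    (J : Π x : N, TangentSpace 𝓘(ℝ, F) x →L[ℝ] TangentSpace 𝓘(ℝ, F) x)
    (ξ : Π p : M, TangentSpace 𝓘(ℝ, F) (ι p)) (p : M) : TangentSpace 𝓘(ℝ, F) (ι p) :=
  normalPart E ι p (J (ι p) (ξ p))

variable (E) in
/-- The `f`-structure in the normal bundle is parallel, `Df = 0`: `D_X (f ξ) = f (D_X ξ)`. -/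
def HasParallelFStructure (ι : M → N)
    (J : Π x : N, TangentSpace 𝓘(ℝ, F) x →L[ℝ] TangentSpace 𝓘(ℝ, F) x) : Prop :=
  ∀ X : Π p : M, TangentSpace 𝓘(ℝ, E) p, IsSmoothField X →
    ∀ ξ : Π p : M, TangentSpace 𝓘(ℝ, F) (ι p), IsSmoothNormalField E ι ξ →
      ∀ p : M, normalCov ι X (fStructure E ι J ξ) p = fStructure E ι J (normalCov ι X ξ) p

end Submanifold

end TotallyReal

end

/-! Write `f` for the normal part of `J` on normal vectors. For tangent `X`, `Y`, applying `J` to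
the Gauss formula and taking normal parts gives `D_X(JY) = J∇_X Y + fσ(X,Y)`, because `J` is
parallel and `JTM` is normal. Since `J² = -1`, `f` kills `JTM`; parallelism of `f` therefore gives
`0 = D_X(fJY) = f(D_X(JY)) = f²σ(X,Y)`. As `f` is skew, `|fσ|² = -g(σ, f²σ) = 0`, so `fσ = 0`
(`normalPart_J_secondFundamentalForm`).

Two consequences follow. First, `D_X(JY) = J∇_X Y`: the map `J` carries the Levi-Civita connection
of `M` to the normal connection on `JTM`, hence `R^⊥(X,Y)JZ = J R(X,Y)Z`
(`normalCurvature_J_mfderiv`). Second, `fH = 0`, so `JH` is tangent and `H = JZ` for the smooth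
tangent field `Z = -JH` (`exists_meanCurvature_eq_J`). Semiparallelity of `H` now says `R(X,Y)Z = 0`
for all `X`, `Y`. Pairing `R(X,Z)Z` with a nonzero `X` orthogonal to `Z`, which exists because `n >
1`, gives `c|X|²|Z|² = 0`. Thus `c = 0`, or `Z` and with it `H` vanish
(`eq_zero_of_curvature_eq_zero`).

Most of the work is the calculus of fields along `ι`. The connection `covAlong` is given by a
formula in a trivialization; it has to be shown to obey the Leibniz rule, to extend the Levi-Civita
connection of `N`, to be metric and torsion free, and to commute with `J`. The metric and `J`
statements use `SmoothAlongAt.induction`, which reduces them to restrictions of vector fields of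
`N`; torsion freeness reduces to the commutator formula `mvfderiv_commutator`. -/

open scoped Topology
open Filter

noncomputable section

namespace TotallyReal

/-! ### Smooth local orthonormal frames and smoothness tested by inner products -/

section LocalFrame

variable {E : Type*} [NormedAddCommGroup E] [NormedSpace ℝ E] [FiniteDimensional ℝ E]
  [CompleteSpace E]
  {M : Type*} [TopologicalSpace M] [ChartedSpace E M] [IsManifold 𝓘(ℝ, E) ∞ M]
  [RiemannianBundle (fun x : M ↦ TangentSpace 𝓘(ℝ, E) x)]
  [IsContMDiffRiemannianBundle 𝓘(ℝ, E) ∞ E (fun x : M ↦ TangentSpace 𝓘(ℝ, E) x)]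
/-- Smoothness of a vector field at a point gives differentiability at all nearby points. -/
lemma eventually_mdiffAt {X : Π x : M, TangentSpace 𝓘(ℝ, E) x} {p : M}
    (hX : ContMDiffAt 𝓘(ℝ, E) 𝓘(ℝ, E).tangent ∞ (T% X) p) : ∀ᶠ q in 𝓝 p, MDiffAt (T% X) q :=
  ((contMDiffAt_iff_contMDiffAt_nhds (n := 1) (by simp)).1 (hX.of_le (by simp))).mono
    fun _ h ↦ h.mdifferentiableAt (by simp)

section Along

variable {E' : Type*} [NormedAddCommGroup E'] [NormedSpace ℝ E']
  {M' : Type*} [TopologicalSpace M'] [ChartedSpace E' M']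

lemma contMDiffAt_inner {f : M' → M} {V W : Π p : M', TangentSpace 𝓘(ℝ, E) (f p)} {p : M'}
    (hV : ContMDiffAt 𝓘(ℝ, E') 𝓘(ℝ, E).tangent ∞
      (fun q ↦ (⟨f q, V q⟩ : TangentBundle 𝓘(ℝ, E) M)) p)
    (hW : ContMDiffAt 𝓘(ℝ, E') 𝓘(ℝ, E).tangent ∞
      (fun q ↦ (⟨f q, W q⟩ : TangentBundle 𝓘(ℝ, E) M)) p) :
    ContMDiffAt 𝓘(ℝ, E') 𝓘(ℝ, ℝ) ∞ (fun q ↦ (inner ℝ (V q) (W q) : ℝ)) p :=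
  ContMDiffAt.inner_bundle (E := fun x : M ↦ TangentSpace 𝓘(ℝ, E) x) hV hW

end Along

/-- Each Gram–Schmidt vector is a combination of earlier ones whose coefficients are quotients of
inner products. Linear independence at `p` alone keeps the denominators nonzero there, which is
enough for smoothness at `p`. -/
lemma contMDiffAt_gramSchmidt {d : ℕ} {s : Fin d → Π x : M, TangentSpace 𝓘(ℝ, E) x} {p : M}
    (hs : ∀ i, ContMDiffAt 𝓘(ℝ, E) 𝓘(ℝ, E).tangent ∞ (T% (s i)) p)
    (hli : LinearIndependent ℝ (fun i ↦ s i p)) (i : Fin d) :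
    ContMDiffAt 𝓘(ℝ, E) 𝓘(ℝ, E).tangent ∞
      (T% (fun x ↦ InnerProductSpace.gramSchmidt ℝ (fun i ↦ s i x) i)) p := by
  induction i using WellFoundedLT.induction with
  | ind i ih =>
    set g : Fin d → Π x : M, TangentSpace 𝓘(ℝ, E) x :=
      fun j x ↦ InnerProductSpace.gramSchmidt ℝ (fun i ↦ s i x) j with hg
    have key : g i = s i - fun x ↦ ∑ j ∈ Finset.Iio i,
        (((fun x ↦ inner ℝ (g j x) (s i x) / inner ℝ (g j x) (g j x)) : M → ℝ) • g j) x := by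
      funext x
      have := InnerProductSpace.gramSchmidt_def'' ℝ (fun i ↦ s i x) i
      simp only [Pi.sub_apply, Pi.smul_apply', hg]
      rw [eq_sub_iff_add_eq]
      conv_rhs => rw [this]
      simp
    change ContMDiffAt 𝓘(ℝ, E) 𝓘(ℝ, E).tangent ∞ (T% (g i)) p
    rw [key]
    refine (hs i).sub_section (ContMDiffAt.sum_section fun j hj ↦ ?_)
    have hgj := ih j (Finset.mem_Iio.1 hj)
    refine ContMDiffAt.smul_section ?_ hgj
    refine ContMDiffAt.div₀ (contMDiffAt_inner hgj (hs i)) (contMDiffAt_inner hgj hgj) ?_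
    exact inner_self_ne_zero.2 (InnerProductSpace.gramSchmidt_ne_zero j hli)

lemma contMDiffAt_gramSchmidtNormed {d : ℕ} {s : Fin d → Π x : M, TangentSpace 𝓘(ℝ, E) x} {p : M}
    (hs : ∀ i, ContMDiffAt 𝓘(ℝ, E) 𝓘(ℝ, E).tangent ∞ (T% (s i)) p)
    (hli : LinearIndependent ℝ (fun i ↦ s i p)) (i : Fin d) :
    ContMDiffAt 𝓘(ℝ, E) 𝓘(ℝ, E).tangent ∞
      (T% (fun x ↦ InnerProductSpace.gramSchmidtNormed ℝ (fun i ↦ s i x) i)) p := by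
  have hg := contMDiffAt_gramSchmidt hs hli i
  have h0 := InnerProductSpace.gramSchmidt_ne_zero i hli
  set g : Π x : M, TangentSpace 𝓘(ℝ, E) x :=
    fun x ↦ InnerProductSpace.gramSchmidt ℝ (fun i ↦ s i x) i with hgdef
  set g' : Π x : M, TangentSpace 𝓘(ℝ, E) x :=
    fun x ↦ InnerProductSpace.gramSchmidtNormed ℝ (fun i ↦ s i x) i with hgdef'
  -- The norm is written as a square root of an inner product, since `Real.sqrt` is smooth away from
  -- zero.
  have key : g' = ((fun x ↦ (Real.sqrt (inner ℝ (g x) (g x)))⁻¹) : M → ℝ) • g := by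
    funext x
    simp only [hgdef', InnerProductSpace.gramSchmidtNormed, Pi.smul_apply', hgdef,
      norm_eq_sqrt_real_inner]
    rfl
  change ContMDiffAt 𝓘(ℝ, E) 𝓘(ℝ, E).tangent ∞ (T% g') p
  rw [key]
  refine ContMDiffAt.smul_section (ContMDiffAt.inv₀ ?_ ?_) hg
  · exact (Real.contDiffAt_sqrt (inner_self_ne_zero.2 h0)).contMDiffAt.comp p
      (contMDiffAt_inner hg hg)
  · exact (Real.sqrt_pos.2 (real_inner_self_pos.2 h0)).ne'

/-- Existence of smooth local orthonormal frames. -/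
theorem exists_orthonormal_frame (p : M) :
    ∃ s : Fin (finrank ℝ E) → Π x : M, TangentSpace 𝓘(ℝ, E) x, ∀ᶠ q in 𝓝 p,
      (∀ i, ContMDiffAt 𝓘(ℝ, E) 𝓘(ℝ, E).tangent ∞ (T% (s i)) q) ∧
      ∃ b : OrthonormalBasis (Fin (finrank ℝ E)) ℝ (TangentSpace 𝓘(ℝ, E) q), ∀ i, b i = s i q := by
  let e := trivializationAt E (fun x : M ↦ TangentSpace 𝓘(ℝ, E) x) p
  let u := e.localFrame (finBasis ℝ E)
  refine ⟨fun i x ↦ InnerProductSpace.gramSchmidtNormed ℝ (fun i ↦ u i x) i, ?_⟩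
  filter_upwards [e.open_baseSet.mem_nhds (FiberBundle.mem_baseSet_trivializationAt' p)] with q hq
  have hu := fun i ↦ contMDiffAt_localFrame_of_mem (I := 𝓘(ℝ, E)) (n := ∞) e (finBasis ℝ E) i hq
  have hli : LinearIndependent ℝ (fun i ↦ u i q) := by
    have : (fun i ↦ u i q) = e.basisAt (finBasis ℝ E) hq := by
      funext i; exact e.localFrame_apply_of_mem_baseSet _ hq
    rw [this]
    exact Basis.linearIndependent _
  refine ⟨fun i ↦ contMDiffAt_gramSchmidtNormed hu hli i, ?_⟩
  have ho := InnerProductSpace.gramSchmidtNormed_orthonormal hli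
  have hspan : ⊤ ≤ Submodule.span ℝ
      (Set.range (InnerProductSpace.gramSchmidtNormed ℝ (fun i ↦ u i q))) := by
    refine (ho.linearIndependent.span_eq_top_of_card_eq_finrank' ?_).ge
    rw [Fintype.card_fin]
    rfl
  exact ⟨OrthonormalBasis.mk ho hspan, fun i ↦ by simp⟩

/-- A vector field is smooth if its inner products with smooth vector fields are. -/
theorem contMDiffAt_of_inner {W : Π x : M, TangentSpace 𝓘(ℝ, E) x} {p : M}
    (h : ∀ X : Π x : M, TangentSpace 𝓘(ℝ, E) x,
      ContMDiffAt 𝓘(ℝ, E) 𝓘(ℝ, E).tangent ∞ (T% X) p →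
      ContMDiffAt 𝓘(ℝ, E) 𝓘(ℝ, ℝ) ∞ (fun q ↦ inner ℝ (X q) (W q)) p) :
    ContMDiffAt 𝓘(ℝ, E) 𝓘(ℝ, E).tangent ∞ (T% W) p := by
  obtain ⟨s, hs⟩ := exists_orthonormal_frame (E := E) p
  have h1 : ContMDiffAt 𝓘(ℝ, E) 𝓘(ℝ, E).tangent ∞
      (T% (fun x ↦ ∑ i, (((fun q ↦ inner ℝ (s i q) (W q)) : M → ℝ) • s i) x)) p :=
    ContMDiffAt.sum_section fun i _ ↦
      ContMDiffAt.smul_section (h _ (hs.self_of_nhds.1 i)) (hs.self_of_nhds.1 i)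
  refine h1.congr_of_eventuallyEq ?_
  filter_upwards [hs] with q hq
  obtain ⟨-, b, hb⟩ := hq
  congr 1
  rw [← b.sum_repr' (W q)]
  simp [hb]

end LocalFrame

/-! ### Derivatives along vector fields and the commutator formula -/

section SecondDerivative

variable {E : Type*} [NormedAddCommGroup E] [NormedSpace ℝ E] [CompleteSpace E]
  {M : Type*} [TopologicalSpace M] [ChartedSpace E M] [IsManifold 𝓘(ℝ, E) ∞ M]
  {G : Type*} [NormedAddCommGroup G] [NormedSpace ℝ G]

/-- The derivative of a smooth map along a smooth vector field is smooth. -/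
lemma contMDiffAt_mfderiv_apply {E' : Type*} [NormedAddCommGroup E'] [NormedSpace ℝ E']
    {M' : Type*} [TopologicalSpace M'] [ChartedSpace E' M'] [IsManifold 𝓘(ℝ, E') ∞ M']
    {f : M → M'} {X : Π x : M, TangentSpace 𝓘(ℝ, E) x} {p : M}
    (hf : ContMDiffAt 𝓘(ℝ, E) 𝓘(ℝ, E') ∞ f p)
    (hX : ContMDiffAt 𝓘(ℝ, E) 𝓘(ℝ, E).tangent ∞ (T% X) p) :
    ContMDiffAt 𝓘(ℝ, E) 𝓘(ℝ, E').tangent ∞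
      (fun q ↦ (⟨f q, mfderiv 𝓘(ℝ, E) 𝓘(ℝ, E') f q (X q)⟩ : TangentBundle 𝓘(ℝ, E') M')) p := by
  have h := ContMDiffAt.mfderiv_const (I := 𝓘(ℝ, E)) (I' := 𝓘(ℝ, E')) (m := ∞) hf (by simp)
  exact ContMDiffAt.clm_apply_of_inCoordinates (E₁ := fun x : M ↦ TangentSpace 𝓘(ℝ, E) x)
    (E₂ := fun x : M' ↦ TangentSpace 𝓘(ℝ, E') x) (b₁ := id) (b₂ := f) h hX hf

lemma contMDiffAt_mvfderiv_apply {f : M → G} {X : Π x : M, TangentSpace 𝓘(ℝ, E) x} {p : M}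
    (hf : ContMDiffAt 𝓘(ℝ, E) 𝓘(ℝ, G) ∞ f p)
    (hX : ContMDiffAt 𝓘(ℝ, E) 𝓘(ℝ, E).tangent ∞ (T% X) p) :
    ContMDiffAt 𝓘(ℝ, E) 𝓘(ℝ, G) ∞ (fun q ↦ mvfderiv 𝓘(ℝ, E) f q (X q)) p := by
  have h := contMDiffAt_mfderiv_apply hf hX
  rw [contMDiffAt_totalSpace] at h
  simpa using! h.2

lemma mvfderiv_vector_comp {E' : Type*} [NormedAddCommGroup E'] [NormedSpace ℝ E']
    {M' : Type*} [TopologicalSpace M'] [ChartedSpace E' M'] {g : M' → G} {f : M → M'} {q : M}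
    (hg : MDifferentiableAt 𝓘(ℝ, E') 𝓘(ℝ, G) g (f q))
    (hf : MDifferentiableAt 𝓘(ℝ, E) 𝓘(ℝ, E') f q) (v : TangentSpace 𝓘(ℝ, E) q) :
    mvfderiv 𝓘(ℝ, E) (g ∘ f) q v =
      mvfderiv 𝓘(ℝ, E') g (f q) (mfderiv 𝓘(ℝ, E) 𝓘(ℝ, E') f q v) :=
  mfderiv_comp_apply q hg hf v

lemma mvfderiv_eq_fderiv {g : E → G} {x v : E} : mvfderiv 𝓘(ℝ, E) g x v = fderiv ℝ g x v := by
  change mfderiv 𝓘(ℝ, E) 𝓘(ℝ, G) g x v = _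
  rw [mfderiv_eq_fderiv]
  rfl

lemma mvfderiv_congr {f g : M → G} {q : M} (h : f =ᶠ[𝓝 q] g) :
    mvfderiv 𝓘(ℝ, E) f q = mvfderiv 𝓘(ℝ, E) g q := by
  ext v
  change mfderiv 𝓘(ℝ, E) 𝓘(ℝ, G) f q v = mfderiv 𝓘(ℝ, E) 𝓘(ℝ, G) g q v
  rw [h.mfderiv_eq]
  rfl

/-- Commutator formula `X(Y h) - Y(X h) = [X, Y] h` for vector-valued functions `h`. -/
theorem mvfderiv_commutator {h : M → G} {X Y : Π x : M, TangentSpace 𝓘(ℝ, E) x} {p : M}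
    (hh : ContMDiffAt 𝓘(ℝ, E) 𝓘(ℝ, G) ∞ h p) (hX : MDiffAt (T% X) p) (hY : MDiffAt (T% Y) p) :
    mvfderiv 𝓘(ℝ, E) (fun q ↦ mvfderiv 𝓘(ℝ, E) h q (Y q)) p (X p)
      - mvfderiv 𝓘(ℝ, E) (fun q ↦ mvfderiv 𝓘(ℝ, E) h q (X q)) p (Y p)
      = mvfderiv 𝓘(ℝ, E) h p (mlieBracket 𝓘(ℝ, E) X Y p) := by
  set ψ := extChartAt 𝓘(ℝ, E) p with hψ
  set H : E → G := h ∘ ψ.symm with hH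
  have hsrc : ∀ᶠ q in 𝓝 p, q ∈ ψ.source := extChartAt_source_mem_nhds p
  have hHs : ContDiffAt ℝ ∞ H (ψ p) := by
    have := (contMDiffAt_iff.1 hh).2
    simpa [contDiffWithinAt_univ] using! this
  have hev : ∀ᶠ q in 𝓝 p, MDiffAt h q :=
    ((contMDiffAt_iff_contMDiffAt_nhds (n := 1) (by simp)).1 (hh.of_le (by simp))).mono
      fun _ h ↦ h.mdifferentiableAt (by simp)
  have hHev : ∀ᶠ q in 𝓝 p, DifferentiableAt ℝ H (ψ q) := by
    have h1 : ∀ᶠ z in 𝓝 (ψ p), DifferentiableAt ℝ H z :=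
      ((hHs.of_le (m := 1) (by simp)).eventually (by simp)).mono
        fun _ h ↦ h.differentiableAt (by simp)
    exact (continuousAt_extChartAt p).eventually h1
  -- `hat V` is the field `V` read in the chart at `p`. The model has no boundary, so derivatives
  -- within `Set.range 𝓘(ℝ, E)` are ordinary ones.
  let hat : (Π x : M, TangentSpace 𝓘(ℝ, E) x) → E → E := fun V ↦
    mpullbackWithin 𝓘(ℝ, E) 𝓘(ℝ, E) ψ.symm V (Set.range 𝓘(ℝ, E))
  have hhat : ∀ V : Π x : M, TangentSpace 𝓘(ℝ, E) x, ∀ q ∈ ψ.source,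
      hat V (ψ q) = mvfderiv 𝓘(ℝ, E) ψ q (V q) := by
    intro V q hq
    have h1 := mfderivWithin_extChartAt_symm_comp_mfderiv_extChartAt' (I := 𝓘(ℝ, E)) hq
    have h2 := mfderiv_extChartAt_comp_mfderivWithin_extChartAt_symm' (I := 𝓘(ℝ, E)) hq
    change (mfderivWithin 𝓘(ℝ, E) 𝓘(ℝ, E) ψ.symm (Set.range 𝓘(ℝ, E)) (ψ q)).inverse
      (V (ψ.symm (ψ q))) = mfderiv 𝓘(ℝ, E) 𝓘(ℝ, E) ψ q (V q)
    have h3 : ψ.symm (ψ q) = q := ψ.left_inv hq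
    have h4 : (mfderivWithin 𝓘(ℝ, E) 𝓘(ℝ, E) ψ.symm (Set.range 𝓘(ℝ, E)) (ψ q)).inverse =
        ((mfderiv 𝓘(ℝ, E) 𝓘(ℝ, E) ψ (ψ.symm (ψ q)) :
          TangentSpace 𝓘(ℝ, E) (ψ.symm (ψ q)) →L[ℝ] E)) :=
      ContinuousLinearMap.inverse_eq
        (mfderivWithin_extChartAt_symm_comp_mfderiv_extChartAt (I := 𝓘(ℝ, E)) (ψ.map_source hq))
        (mfderiv_extChartAt_comp_mfderivWithin_extChartAt_symm (I := 𝓘(ℝ, E)) (ψ.map_source hq))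
    rw [h4, h3]
  have hfun : ∀ V : Π x : M, TangentSpace 𝓘(ℝ, E) x,
      (fun q ↦ mvfderiv 𝓘(ℝ, E) h q (V q)) =ᶠ[𝓝 p] (fun z ↦ fderiv ℝ H z (hat V z)) ∘ ψ := by
    intro V
    filter_upwards [hHev, hsrc, hsrc.eventually_nhds] with q hHq hq hq'
    have h1 : h =ᶠ[𝓝 q] H ∘ ψ := by
      filter_upwards [hq'] with y hy
      simp [hH, ψ.left_inv hy]
    have h2 : mvfderiv 𝓘(ℝ, E) h q = mvfderiv 𝓘(ℝ, E) (H ∘ ψ) q := mvfderiv_congr h1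
    rw [h2, mvfderiv_vector_comp hHq.mdifferentiableAt
      (mdifferentiableAt_extChartAt (by simpa [hψ] using hq)), Function.comp_apply, hhat V q hq]
    exact mvfderiv_eq_fderiv
  -- The tangent space at `p` is identified with `E` by the chart at `p` itself, so the differential
  -- of that chart at `p` is the identity.
  have hself : ∀ v : TangentSpace 𝓘(ℝ, E) p, mvfderiv 𝓘(ℝ, E) ψ p v = v := by
    intro v
    change mfderiv 𝓘(ℝ, E) 𝓘(ℝ, E) ψ p v = v
    rw [hψ, mfderiv_extChartAt_self]
    rfl
  have hhatd : ∀ V : Π x : M, TangentSpace 𝓘(ℝ, E) x, MDiffAt (T% V) p →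
      DifferentiableAt ℝ (hat V) (ψ p) := by
    intro V hV
    have := MDifferentiableWithinAt.differentiableWithinAt_mpullbackWithin_vectorField
      (mdifferentiableWithinAt_univ.2 hV)
    have hr : (extChartAt 𝓘(ℝ, E) p).symm ⁻¹' Set.univ ∩ Set.range 𝓘(ℝ, E) = Set.univ := by simp
    rw [hr] at this
    exact differentiableWithinAt_univ.1 this
  -- The product rule splits `v(V h)` into a Hessian term and a term in the derivative of `hat V`.
  -- On antisymmetrizing, the Hessian terms cancel by symmetry (`hsymm`) and the others form the
  -- bracket (`hbr`).
  have hder : ∀ V : Π x : M, TangentSpace 𝓘(ℝ, E) x, MDiffAt (T% V) p →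
      ∀ v : TangentSpace 𝓘(ℝ, E) p,
      mvfderiv 𝓘(ℝ, E) (fun q ↦ mvfderiv 𝓘(ℝ, E) h q (V q)) p v
        = fderiv ℝ (fderiv ℝ H) (ψ p) v (V p) + fderiv ℝ H (ψ p) (fderiv ℝ (hat V) (ψ p) v) := by
    intro V hV v
    have h1 := hhatd V hV
    have h2 : DifferentiableAt ℝ (fderiv ℝ H) (ψ p) :=
      (hHs.fderiv_right (m := 1) (one_add_one_eq_two.trans_le ENat.LEInfty.out)).differentiableAt (by simp)
    have hp : hat V (ψ p) = V p := (hhat V p (mem_extChartAt_source p)).trans (hself _)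
    rw [mvfderiv_congr (hfun V), mvfderiv_vector_comp (h2.clm_apply h1).mdifferentiableAt
      (mdifferentiableAt_extChartAt (mem_chart_source E p))]
    have h3 : mfderiv 𝓘(ℝ, E) 𝓘(ℝ, E) ψ p v = v := hself v
    rw [h3]
    refine mvfderiv_eq_fderiv.trans ?_
    rw [fderiv_clm_apply h2 h1]
    rw [hp]
    exact add_comm _ _
  have hbr : mlieBracket 𝓘(ℝ, E) X Y p =
      fderiv ℝ (hat Y) (ψ p) (X p) - fderiv ℝ (hat X) (ψ p) (Y p) := by
    have hp : ∀ V : Π x : M, TangentSpace 𝓘(ℝ, E) x, hat V (ψ p) = V p := fun V ↦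
      (hhat V p (mem_extChartAt_source p)).trans (hself _)
    have hb : mlieBracket 𝓘(ℝ, E) X Y p =
        lieBracketWithin ℝ (hat X) (hat Y) (ψ.symm ⁻¹' Set.univ ∩ Set.range 𝓘(ℝ, E)) (ψ p) := by
      rw [mlieBracket, mlieBracketWithin_apply, mfderiv_extChartAt_self]
      exact congrArg (fun f : E →L[ℝ] E ↦ f _) ContinuousLinearMap.inverse_id
    have hr : ψ.symm ⁻¹' Set.univ ∩ Set.range 𝓘(ℝ, E) = Set.univ := by simp
    rw [hb, hr, lieBracketWithin_univ, lieBracket, hp X, hp Y]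
  have hsymm : IsSymmSndFDerivAt ℝ H (ψ p) :=
    hHs.isSymmSndFDerivAt (by rw [minSmoothness_of_isRCLikeNormedField]; exact ENat.LEInfty.out)
  rw [hder Y hY, hder X hX, hbr]
  have h5 : ∀ w : E, mvfderiv 𝓘(ℝ, E) h p w = fderiv ℝ H (ψ p) w := by
    intro w
    have h1 : h =ᶠ[𝓝 p] H ∘ ψ := by
      filter_upwards [hsrc] with y hy
      simp [hH, ψ.left_inv hy]
    rw [mvfderiv_congr h1]
    refine (mvfderiv_vector_comp hHev.self_of_nhds.mdifferentiableAt
      (mdifferentiableAt_extChartAt (mem_chart_source E p)) w).trans ?_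
    refine (congrArg (mvfderiv 𝓘(ℝ, E) H (ψ p)) (hself w)).trans ?_
    exact mvfderiv_eq_fderiv
  refine Eq.trans ?_ (h5 _).symm
  refine Eq.trans ?_ (map_sub (fderiv ℝ H (ψ p)) _ _).symm
  have h6 : fderiv ℝ (fderiv ℝ H) (ψ p) (X p) (Y p) = fderiv ℝ (fderiv ℝ H) (ψ p) (Y p) (X p) :=
    hsymm (X p) (Y p)
  exact (congrArg (fun a ↦ a + _ - _) h6).trans (add_sub_add_left_eq_sub _ _ _)

end SecondDerivative

/-! ### Smoothness of the Levi-Civita connection and global extension of tangent vectors -/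

section LeviCivitaSmooth

variable {E : Type*} [NormedAddCommGroup E] [NormedSpace ℝ E] [FiniteDimensional ℝ E]
  [CompleteSpace E]
  {M : Type*} [TopologicalSpace M] [ChartedSpace E M] [IsManifold 𝓘(ℝ, E) ∞ M]
  [RiemannianBundle (fun x : M ↦ TangentSpace 𝓘(ℝ, E) x)]
  [IsContMDiffRiemannianBundle 𝓘(ℝ, E) ∞ E (fun x : M ↦ TangentSpace 𝓘(ℝ, E) x)]
variable {X Y Z : Π x : M, TangentSpace 𝓘(ℝ, E) x} {p : M}

lemma contMDiffAt_mlieBracket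
    (hX : ContMDiffAt 𝓘(ℝ, E) 𝓘(ℝ, E).tangent ∞ (T% X) p)
    (hY : ContMDiffAt 𝓘(ℝ, E) 𝓘(ℝ, E).tangent ∞ (T% Y) p) :
    ContMDiffAt 𝓘(ℝ, E) 𝓘(ℝ, E).tangent ∞ (T% (mlieBracket 𝓘(ℝ, E) X Y)) p := by
  have : IsManifold 𝓘(ℝ, E) ((⊤ : ℕ∞) + 1) M := by simpa using ‹IsManifold 𝓘(ℝ, E) ∞ M›
  have : IsManifold 𝓘(ℝ, E) (minSmoothness ℝ 2) M := by
    rw [minSmoothness_of_isRCLikeNormedField]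
    infer_instance
  exact ContMDiffAt.mlieBracket_vectorField (n := ⊤) (m := ⊤) hX hY (by
    rw [minSmoothness_of_isRCLikeNormedField]; simp)

lemma contMDiffAt_koszul
    (hX : ContMDiffAt 𝓘(ℝ, E) 𝓘(ℝ, E).tangent ∞ (T% X) p)
    (hY : ContMDiffAt 𝓘(ℝ, E) 𝓘(ℝ, E).tangent ∞ (T% Y) p)
    (hZ : ContMDiffAt 𝓘(ℝ, E) 𝓘(ℝ, E).tangent ∞ (T% Z) p) :
    ContMDiffAt 𝓘(ℝ, E) 𝓘(ℝ, ℝ) ∞ (koszul Y X Z) p := by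
  have h1 := contMDiffAt_mvfderiv_apply (contMDiffAt_inner (f := id) hY hZ) hX
  have h2 := contMDiffAt_mvfderiv_apply (contMDiffAt_inner (f := id) hZ hX) hY
  have h3 := contMDiffAt_mvfderiv_apply (contMDiffAt_inner (f := id) hX hY) hZ
  have h4 := contMDiffAt_inner (f := id) hY (contMDiffAt_mlieBracket hX hZ)
  have h5 := contMDiffAt_inner (f := id) hZ (contMDiffAt_mlieBracket hY hX)
  have h6 := contMDiffAt_inner (f := id) hX (contMDiffAt_mlieBracket hZ hY)
  exact ((((h1.add h2).sub h3).sub h4).sub h5).add h6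

/-- The covariant derivative of smooth vector fields is smooth. -/
theorem contMDiffAt_leviCivita
    (hX : ContMDiffAt 𝓘(ℝ, E) 𝓘(ℝ, E).tangent ∞ (T% X) p)
    (hY : ContMDiffAt 𝓘(ℝ, E) 𝓘(ℝ, E).tangent ∞ (T% Y) p) :
    ContMDiffAt 𝓘(ℝ, E) 𝓘(ℝ, E).tangent ∞ (T% (fun q ↦ leviCivita E M Y q (X q))) p := by
  refine contMDiffAt_of_inner fun Z hZ ↦ ?_
  refine (contMDiffAt_const (c := (1 / 2 : ℝ)) |>.mul
    (contMDiffAt_koszul hX hY hZ)).congr_of_eventuallyEq ?_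
  filter_upwards [eventually_mdiffAt hX, eventually_mdiffAt hY, eventually_mdiffAt hZ]
    with q h1 h2 h3
  rw [real_inner_comm]
  exact inner_leviCivitaFun h1 h2 h3

/-- A tangent vector extends to a global smooth vector field, agreeing locally with
`FiberBundle.extend`. -/
lemma exists_isSmoothField_extend [T2Space M] (v : TangentSpace 𝓘(ℝ, E) p) :
    ∃ X : Π x : M, TangentSpace 𝓘(ℝ, E) x, IsSmoothField X ∧ X p = v ∧
      ∀ᶠ q in 𝓝 p, X q = FiberBundle.extend E v q := by
  obtain ⟨u, hu, hs⟩ := FiberBundle.exists_contMDiffOn_extend (k := ∞) 𝓘(ℝ, E) E v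
  obtain ⟨ψ, hψ, -⟩ := (SmoothBumpFunction.nhds_basis_support (I := 𝓘(ℝ, E))
    (interior_mem_nhds.2 hu)).mem_iff.1 (interior_mem_nhds.2 hu)
  have h1 : ∀ᶠ q in 𝓝 p, (((ψ : M → ℝ) • FiberBundle.extend E v) q : TangentSpace 𝓘(ℝ, E) q) =
      FiberBundle.extend E v q := by
    filter_upwards [ψ.eventuallyEq_one] with q hq
    simp [hq]
  refine ⟨(ψ : M → ℝ) • FiberBundle.extend E v, ?_, ?_, h1⟩
  -- The closed support of the bump function lies where the local extension is smooth, so the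
  -- product is smooth on all of `M`.
  · exact ContMDiffOn.smul_section_of_tsupport ψ.contMDiff.contMDiffOn isOpen_interior hψ
      (hs.mono interior_subset)
  · rw [h1.self_of_nhds, FiberBundle.extend_apply_self]

end LeviCivitaSmooth

/-! ### The connection induced on fields along a map -/

section Along

variable {E : Type*} [NormedAddCommGroup E] [NormedSpace ℝ E] [FiniteDimensional ℝ E]
  [CompleteSpace E]
  {M : Type*} [TopologicalSpace M] [ChartedSpace E M] [IsManifold 𝓘(ℝ, E) ∞ M]
  [RiemannianBundle (fun x : M ↦ TangentSpace 𝓘(ℝ, E) x)]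
  [IsContMDiffRiemannianBundle 𝓘(ℝ, E) ∞ E (fun x : M ↦ TangentSpace 𝓘(ℝ, E) x)]
  {F : Type*} [NormedAddCommGroup F] [NormedSpace ℝ F] [FiniteDimensional ℝ F]
  [CompleteSpace F]
  {N : Type*} [TopologicalSpace N] [ChartedSpace F N] [IsManifold 𝓘(ℝ, F) ∞ N]
  [RiemannianBundle (fun x : N ↦ TangentSpace 𝓘(ℝ, F) x)]
  [IsContMDiffRiemannianBundle 𝓘(ℝ, F) ∞ F (fun x : N ↦ TangentSpace 𝓘(ℝ, F) x)]
/-- The field `V` along `ι : M → N` is smooth at `p`. -/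
def SmoothAlongAt (ι : M → N) (V : Π p : M, TangentSpace 𝓘(ℝ, F) (ι p)) (p : M) : Prop :=
  ContMDiffAt 𝓘(ℝ, E) 𝓘(ℝ, F).tangent ∞ (fun q ↦ (⟨ι q, V q⟩ : TangentBundle 𝓘(ℝ, F) N)) p

/-- The field `V` along `ι : M → N` is differentiable at `p`. -/
def DiffAlongAt (ι : M → N) (V : Π p : M, TangentSpace 𝓘(ℝ, F) (ι p)) (p : M) : Prop :=
  MDifferentiableAt 𝓘(ℝ, E) 𝓘(ℝ, F).tangent (fun q ↦ (⟨ι q, V q⟩ : TangentBundle 𝓘(ℝ, F) N)) p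

/-- The principal part at `q` of a field along `ι` in the trivialization of `TN` at `ι p`. -/
def principalPart (ι : M → N) (V : Π p : M, TangentSpace 𝓘(ℝ, F) (ι p)) (p q : M) : F :=
  (trivializationAt F (fun x : N ↦ TangentSpace 𝓘(ℝ, F) x) (ι p) ⟨ι q, V q⟩).2

variable {ι : M → N} {V V' : Π p : M, TangentSpace 𝓘(ℝ, F) (ι p)} {p : M}

lemma smoothAlongAt_iff : SmoothAlongAt (E := E) ι V p ↔
    ContMDiffAt 𝓘(ℝ, E) 𝓘(ℝ, F) ∞ ι p ∧ ContMDiffAt 𝓘(ℝ, E) 𝓘(ℝ, F) ∞ (principalPart ι V p) p :=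
  contMDiffAt_totalSpace

lemma diffAlongAt_iff : DiffAlongAt (E := E) ι V p ↔
    MDifferentiableAt 𝓘(ℝ, E) 𝓘(ℝ, F) ι p ∧
      MDifferentiableAt 𝓘(ℝ, E) 𝓘(ℝ, F) (principalPart ι V p) p :=
  mdifferentiableAt_totalSpace _ _

lemma SmoothAlongAt.eventually (h : SmoothAlongAt (E := E) ι V p) :
    ∀ᶠ q in 𝓝 p, DiffAlongAt (E := E) ι V q :=
  ((contMDiffAt_iff_contMDiffAt_nhds (n := 1) (by simp)).1
    (ContMDiffAt.of_le h (by simp))).mono fun _ h ↦ h.mdifferentiableAt (by simp)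

lemma SmoothAlongAt.diff (h : SmoothAlongAt (E := E) ι V p) : DiffAlongAt (E := E) ι V p :=
  h.eventually.self_of_nhds

lemma eventually_mem_baseSet (hι : ContinuousAt ι p) : ∀ᶠ q in 𝓝 p,
    ι q ∈ (trivializationAt F (fun x : N ↦ TangentSpace 𝓘(ℝ, F) x) (ι p)).baseSet :=
  hι.eventually ((trivializationAt F (fun x : N ↦ TangentSpace 𝓘(ℝ, F) x)
    (ι p)).open_baseSet.mem_nhds (FiberBundle.mem_baseSet_trivializationAt' (ι p)))

lemma principalPart_add {q : M}
    (hq : ι q ∈ (trivializationAt F (fun x : N ↦ TangentSpace 𝓘(ℝ, F) x) (ι p)).baseSet) :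
    principalPart ι (fun q ↦ V q + V' q) p q = principalPart ι V p q + principalPart ι V' p q :=
  ((trivializationAt F (fun x : N ↦ TangentSpace 𝓘(ℝ, F) x) (ι p)).linear ℝ hq).map_add _ _

lemma principalPart_smul {q : M} {a : M → ℝ}
    (hq : ι q ∈ (trivializationAt F (fun x : N ↦ TangentSpace 𝓘(ℝ, F) x) (ι p)).baseSet) :
    principalPart ι (fun q ↦ a q • V q) p q = a q • principalPart ι V p q :=
  ((trivializationAt F (fun x : N ↦ TangentSpace 𝓘(ℝ, F) x) (ι p)).linear ℝ hq).map_smul _ _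

lemma SmoothAlongAt.add (h : SmoothAlongAt (E := E) ι V p) (h' : SmoothAlongAt (E := E) ι V' p) :
    SmoothAlongAt (E := E) ι (fun q ↦ V q + V' q) p := by
  rw [smoothAlongAt_iff] at h h' ⊢
  refine ⟨h.1, (h.2.add h'.2).congr_of_eventuallyEq ?_⟩
  exact (eventually_mem_baseSet h.1.continuousAt).mono fun q hq ↦ principalPart_add hq

lemma SmoothAlongAt.smul {a : M → ℝ} (ha : ContMDiffAt 𝓘(ℝ, E) 𝓘(ℝ, ℝ) ∞ a p)
    (h : SmoothAlongAt (E := E) ι V p) : SmoothAlongAt (E := E) ι (fun q ↦ a q • V q) p := by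
  rw [smoothAlongAt_iff] at h ⊢
  refine ⟨h.1, (ha.smul h.2).congr_of_eventuallyEq ?_⟩
  exact (eventually_mem_baseSet h.1.continuousAt).mono fun q hq ↦ principalPart_smul hq

lemma SmoothAlongAt.comp {U : Π x : N, TangentSpace 𝓘(ℝ, F) x}
    (hι : ContMDiffAt 𝓘(ℝ, E) 𝓘(ℝ, F) ∞ ι p)
    (hU : ContMDiffAt 𝓘(ℝ, F) 𝓘(ℝ, F).tangent ∞ (T% U) (ι p)) :
    SmoothAlongAt (E := E) ι (fun q ↦ U (ι q)) p :=
  ContMDiffAt.comp p hU hι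

lemma covAlong_eq (v : TangentSpace 𝓘(ℝ, E) p) :
    covAlong ι V p v =
      (trivializationAt F (fun x : N ↦ TangentSpace 𝓘(ℝ, F) x) (ι p)).symm (ι p)
        (mvfderiv 𝓘(ℝ, E) (principalPart ι V p) p v) +
      leviCivita F N (FiberBundle.extend F (V p)) (ι p) (mfderiv 𝓘(ℝ, E) 𝓘(ℝ, F) ι p v) :=
  rfl

lemma symm_add {x y : N} {w w' : F}
    (hy : y ∈ (trivializationAt F (fun x : N ↦ TangentSpace 𝓘(ℝ, F) x) x).baseSet) :
    (trivializationAt F (fun x : N ↦ TangentSpace 𝓘(ℝ, F) x) x).symm y (w + w') =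
      (trivializationAt F (fun x : N ↦ TangentSpace 𝓘(ℝ, F) x) x).symm y w +
        (trivializationAt F (fun x : N ↦ TangentSpace 𝓘(ℝ, F) x) x).symm y w' := by
  have h := fun w ↦ Trivialization.symmₗ_apply (R := ℝ)
    (trivializationAt F (fun x : N ↦ TangentSpace 𝓘(ℝ, F) x) x) hy w
  rw [← h, ← h, ← h, map_add]

lemma symm_smul {x y : N} {a : ℝ} {w : F}
    (hy : y ∈ (trivializationAt F (fun x : N ↦ TangentSpace 𝓘(ℝ, F) x) x).baseSet) :
    (trivializationAt F (fun x : N ↦ TangentSpace 𝓘(ℝ, F) x) x).symm y (a • w) =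
      a • (trivializationAt F (fun x : N ↦ TangentSpace 𝓘(ℝ, F) x) x).symm y w := by
  have h := fun w ↦ Trivialization.symmₗ_apply (R := ℝ)
    (trivializationAt F (fun x : N ↦ TangentSpace 𝓘(ℝ, F) x) x) hy w
  rw [← h, ← h, map_smul]

/-- `FiberBundle.extend` has constant principal part, hence is linear in the vector near `x`. This
and the scalar version below make the Christoffel term of `covAlong` linear in the value of the
field. -/
lemma leviCivita_extend_add {x : N} (v w u : TangentSpace 𝓘(ℝ, F) x) :
    leviCivita F N (FiberBundle.extend F (v + w)) x u =
      leviCivita F N (FiberBundle.extend F v) x u +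
        leviCivita F N (FiberBundle.extend F w) x u := by
  have hv := FiberBundle.mdifferentiableAt_extend 𝓘(ℝ, F) F v
  have hw := FiberBundle.mdifferentiableAt_extend 𝓘(ℝ, F) F w
  let t := trivializationAt F (fun x : N ↦ TangentSpace 𝓘(ℝ, F) x) x
  have h : (t ⟨x, v + w⟩).2 = (t ⟨x, v⟩).2 + (t ⟨x, w⟩).2 :=
    (t.linear ℝ (FiberBundle.mem_baseSet_trivializationAt' x)).map_add v w
  have he : ∀ᶠ y in 𝓝 x, (FiberBundle.extend F (v + w) : Π y : N, TangentSpace 𝓘(ℝ, F) y) y =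
      (FiberBundle.extend F v + FiberBundle.extend F w : Π y : N, TangentSpace 𝓘(ℝ, F) y) y := by
    filter_upwards [t.open_baseSet.mem_nhds (FiberBundle.mem_baseSet_trivializationAt' x)]
      with y hy
    exact (congrArg (t.symm y) h).trans (symm_add hy)
  rw [(leviCivita F N).isCovariantDerivativeOnUniv.congr_of_eventuallyEq
    (FiberBundle.mdifferentiableAt_extend 𝓘(ℝ, F) F _) (mdifferentiableAt_add_section hv hw)
    univ_mem he, (leviCivita F N).isCovariantDerivativeOnUniv.add hv hw]
  rfl

lemma leviCivita_extend_smul {x : N} (a : ℝ) (v u : TangentSpace 𝓘(ℝ, F) x) :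
    leviCivita F N (FiberBundle.extend F (a • v)) x u =
      a • leviCivita F N (FiberBundle.extend F v) x u := by
  have hv := FiberBundle.mdifferentiableAt_extend 𝓘(ℝ, F) F v
  let t := trivializationAt F (fun x : N ↦ TangentSpace 𝓘(ℝ, F) x) x
  have h : (t ⟨x, a • v⟩).2 = a • (t ⟨x, v⟩).2 :=
    (t.linear ℝ (FiberBundle.mem_baseSet_trivializationAt' x)).map_smul a v
  have ha : MDiffAt (fun _ : N ↦ a) x := mdifferentiableAt_const
  have he : ∀ᶠ y in 𝓝 x, (FiberBundle.extend F (a • v) : Π y : N, TangentSpace 𝓘(ℝ, F) y) y =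
      ((fun _ : N ↦ a) • FiberBundle.extend F v : Π y : N, TangentSpace 𝓘(ℝ, F) y) y := by
    filter_upwards [t.open_baseSet.mem_nhds (FiberBundle.mem_baseSet_trivializationAt' x)]
      with y hy
    exact (congrArg (t.symm y) h).trans (symm_smul hy)
  rw [(leviCivita F N).isCovariantDerivativeOnUniv.congr_of_eventuallyEq
    (FiberBundle.mdifferentiableAt_extend 𝓘(ℝ, F) F _) (ha.smul_section hv)
    univ_mem he, (leviCivita F N).isCovariantDerivativeOnUniv.leibniz hv ha, mvfderiv_const]
  simp

lemma covAlong_congr (hVV' : ∀ᶠ q in 𝓝 p, V q = V' q) (v : TangentSpace 𝓘(ℝ, E) p) :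
    covAlong ι V p v = covAlong ι V' p v := by
  have h : principalPart ι V p =ᶠ[𝓝 p] principalPart ι V' p :=
    hVV'.mono fun q hq ↦ by simp [principalPart, hq]
  rw [covAlong_eq, covAlong_eq, hVV'.self_of_nhds, mvfderiv_congr h]

lemma covAlong_add (h : DiffAlongAt (E := E) ι V p) (h' : DiffAlongAt (E := E) ι V' p)
    (v : TangentSpace 𝓘(ℝ, E) p) :
    covAlong ι (fun q ↦ V q + V' q) p v = covAlong ι V p v + covAlong ι V' p v := by
  rw [diffAlongAt_iff] at h h'
  have h1 : principalPart ι (fun q ↦ V q + V' q) p =ᶠ[𝓝 p]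
      principalPart ι V p + principalPart ι V' p :=
    (eventually_mem_baseSet h.1.continuousAt).mono fun q hq ↦ principalPart_add hq
  rw [covAlong_eq, covAlong_eq, covAlong_eq, mvfderiv_congr h1, mvfderiv_add h.2 h'.2,
    leviCivita_extend_add, add_apply, symm_add (FiberBundle.mem_baseSet_trivializationAt' (ι p))]
  exact add_add_add_comm _ _ _ _

/-- The extra term comes from the derivative of the principal part only: the Christoffel term sees
just the value `a p • V p`. -/
lemma covAlong_smul {a : M → ℝ} (ha : MDifferentiableAt 𝓘(ℝ, E) 𝓘(ℝ, ℝ) a p)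
    (h : DiffAlongAt (E := E) ι V p) (v : TangentSpace 𝓘(ℝ, E) p) :
    covAlong ι (fun q ↦ a q • V q) p v =
      a p • covAlong ι V p v + mvfderiv 𝓘(ℝ, E) a p v • V p := by
  rw [diffAlongAt_iff] at h
  have h1 : principalPart ι (fun q ↦ a q • V q) p =ᶠ[𝓝 p] a • principalPart ι V p :=
    (eventually_mem_baseSet h.1.continuousAt).mono fun q hq ↦ principalPart_smul hq
  rw [covAlong_eq, covAlong_eq, mvfderiv_congr h1, mvfderiv_smul ha h.2,
    leviCivita_extend_smul]
  have hb := FiberBundle.mem_baseSet_trivializationAt' (E := fun x : N ↦ TangentSpace 𝓘(ℝ, F) x)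
    (F := F) (ι p)
  let t := trivializationAt F (fun x : N ↦ TangentSpace 𝓘(ℝ, F) x) (ι p)
  have h2 : t.symm (ι p) (principalPart ι V p p) = V p := t.symm_apply_apply_mk hb (V p)
  refine (congrArg (· + _) ((symm_add hb).trans (congrArg₂ (· + ·) (symm_smul hb)
    ((symm_smul hb).trans (congrArg _ h2))))).trans ?_
  exact (add_right_comm _ _ _).trans (congrArg (· + _) (smul_add _ _ _).symm)

/-- Along the identity map, `covAlong` is the Levi-Civita connection. -/
lemma covAlong_id {U : Π x : N, TangentSpace 𝓘(ℝ, F) x} {x : N} (hU : MDiffAt (T% U) x)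
    (w : TangentSpace 𝓘(ℝ, F) x) :
    covAlong (E := F) (F := F) (id : N → N) U x w = leviCivita F N U x w := by
  let cov : (Π x : N, TangentSpace 𝓘(ℝ, F) x) → TangentSpace 𝓘(ℝ, F) x := fun U ↦
    covAlong (E := F) (F := F) (id : N → N) U x w
  -- The difference of two connections is tensorial, so it depends only on `U x`. It suffices to
  -- compare them on the extension of `U x`, whose principal part is constant and where `covAlong`
  -- reduces to its Christoffel term.
  have ht : TensorialAt 𝓘(ℝ, F) F (fun U : Π x : N, TangentSpace 𝓘(ℝ, F) x ↦
      (leviCivita F N U x w - cov U : TangentSpace 𝓘(ℝ, F) x)) x :=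
    { smul := by
        intro f U hf hU
        have h1 : cov (f • U) = f x • cov U + mvfderiv 𝓘(ℝ, F) f x w • U x :=
          covAlong_smul (E := F) (ι := id) hf hU w
        have h2 := (leviCivita F N).isCovariantDerivativeOnUniv.leibniz hU hf
        rw [h1, h2]
        simp [smul_sub]
      add := by
        intro U U' hU hU'
        have h1 : cov (U + U') = cov U + cov U' := covAlong_add (E := F) (ι := id) hU hU' w
        have h2 := (leviCivita F N).isCovariantDerivativeOnUniv.add hU hU'
        rw [h1, h2]
        simp
        abel }
  have hp := ht.pointwise hU (FiberBundle.mdifferentiableAt_extend 𝓘(ℝ, F) F (U x))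
    (by simp)
  have h0 : cov (FiberBundle.extend F (U x)) =
      leviCivita F N (FiberBundle.extend F (U x)) x w := by
    let t := trivializationAt F (fun x : N ↦ TangentSpace 𝓘(ℝ, F) x) x
    set W : Π y : N, TangentSpace 𝓘(ℝ, F) y := FiberBundle.extend F (U x) with hW
    have hb := FiberBundle.mem_baseSet_trivializationAt' (E := fun x : N ↦ TangentSpace 𝓘(ℝ, F) x)
      (F := F) x
    have hc : principalPart (id : N → N) W x =ᶠ[𝓝 x] fun _ ↦ (t ⟨x, U x⟩).2 := by
      filter_upwards [t.open_baseSet.mem_nhds hb] with y hy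
      change (t ⟨y, t.symm y (t ⟨x, U x⟩).2⟩).2 = _
      rw [t.apply_mk_symm hy]
    have hm : mfderiv 𝓘(ℝ, F) 𝓘(ℝ, F) (id : N → N) x w = w := by rw [mfderiv_id]; rfl
    have hx : W x = U x := by simp [hW]
    have hz : t.symm x 0 = 0 := by
      rw [← Trivialization.symmₗ_apply (R := ℝ) t hb, map_zero]
    have hd : mvfderiv 𝓘(ℝ, F) (principalPart (id : N → N) W x) x w = 0 := by
      rw [mvfderiv_congr hc, mvfderiv_const]
      rfl
    refine (covAlong_eq (E := F) (ι := (id : N → N)) w).trans ?_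
    rw [hm]
    change t.symm x (mvfderiv 𝓘(ℝ, F) (principalPart (id : N → N) W x) x w) +
      leviCivita F N (FiberBundle.extend F (W x)) x w = leviCivita F N W x w
    rw [hx, hd, hz, zero_add]
  have h1 : leviCivita F N U x w - cov U = 0 := hp.trans (sub_eq_zero.2 h0.symm)
  exact (sub_eq_zero.1 h1).symm

/-- Chain rule: the covariant derivative of a vector field of `N` restricted to `ι`. -/
lemma covAlong_comp {U : Π x : N, TangentSpace 𝓘(ℝ, F) x}
    (hι : MDifferentiableAt 𝓘(ℝ, E) 𝓘(ℝ, F) ι p) (hU : MDiffAt (T% U) (ι p))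
    (v : TangentSpace 𝓘(ℝ, E) p) :
    covAlong ι (fun q ↦ U (ι q)) p v =
      leviCivita F N U (ι p) (mfderiv 𝓘(ℝ, E) 𝓘(ℝ, F) ι p v) := by
  -- After passing to `covAlong` of the identity, both sides have the same Christoffel term, and the
  -- principal parts differ by composition with `ι`, so the ordinary chain rule finishes.
  rw [← covAlong_id hU, covAlong_eq, covAlong_eq]
  have hU' : DiffAlongAt (E := F) (id : N → N) U (ι p) := hU
  have h1 : principalPart ι (fun q ↦ U (ι q)) p = principalPart (id : N → N) U (ι p) ∘ ι := rfl
  have hm : ∀ w, mfderiv 𝓘(ℝ, F) 𝓘(ℝ, F) (id : N → N) (ι p) w = w := by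
    intro w; rw [mfderiv_id]; rfl
  rw [h1, mvfderiv_vector_comp (diffAlongAt_iff.1 hU').2 hι, hm]
  rfl

end Along

/-! ### Induction on fields along a map; compatibility with the metric and with `J` -/

section AlongInduction

variable {E : Type*} [NormedAddCommGroup E] [NormedSpace ℝ E] [FiniteDimensional ℝ E]
  [CompleteSpace E]
  {M : Type*} [TopologicalSpace M] [ChartedSpace E M] [IsManifold 𝓘(ℝ, E) ∞ M]
  [RiemannianBundle (fun x : M ↦ TangentSpace 𝓘(ℝ, E) x)]
  [IsContMDiffRiemannianBundle 𝓘(ℝ, E) ∞ E (fun x : M ↦ TangentSpace 𝓘(ℝ, E) x)]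
  {F : Type*} [NormedAddCommGroup F] [NormedSpace ℝ F] [FiniteDimensional ℝ F]
  [CompleteSpace F]
  {N : Type*} [TopologicalSpace N] [ChartedSpace F N] [IsManifold 𝓘(ℝ, F) ∞ N]
  [RiemannianBundle (fun x : N ↦ TangentSpace 𝓘(ℝ, F) x)]
  [IsContMDiffRiemannianBundle 𝓘(ℝ, F) ∞ F (fun x : N ↦ TangentSpace 𝓘(ℝ, F) x)]
variable {ι : M → N} {V V' : Π p : M, TangentSpace 𝓘(ℝ, F) (ι p)} {p : M}

/-- Induction principle for smooth fields along `ι`: locally, they are generated over the smooth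
functions on `M` by the restrictions of vector fields of `N`. -/
theorem SmoothAlongAt.induction {P : (Π p : M, TangentSpace 𝓘(ℝ, F) (ι p)) → Prop}
    (congr : ∀ V V' : Π p : M, TangentSpace 𝓘(ℝ, F) (ι p),
      (∀ᶠ q in 𝓝 p, V q = V' q) → P V → P V')
    (add : ∀ V V' : Π p : M, TangentSpace 𝓘(ℝ, F) (ι p), SmoothAlongAt (E := E) ι V p →
      SmoothAlongAt (E := E) ι V' p → P V → P V' → P (fun q ↦ V q + V' q))
    (smul : ∀ (a : M → ℝ) (V : Π p : M, TangentSpace 𝓘(ℝ, F) (ι p)),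
      ContMDiffAt 𝓘(ℝ, E) 𝓘(ℝ, ℝ) ∞ a p →
      SmoothAlongAt (E := E) ι V p → P V → P (fun q ↦ a q • V q))
    (comp : ∀ U : Π x : N, TangentSpace 𝓘(ℝ, F) x,
      ContMDiffAt 𝓘(ℝ, F) 𝓘(ℝ, F).tangent ∞ (T% U) (ι p) → P (fun q ↦ U (ι q)))
    (hV : SmoothAlongAt (E := E) ι V p) : P V := by
  classical
  have hV' := smoothAlongAt_iff.1 hV
  let e := trivializationAt F (fun x : N ↦ TangentSpace 𝓘(ℝ, F) x) (ι p)
  let b := finBasis ℝ F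
  let U := e.localFrame b
  have hU : ∀ j, ContMDiffAt 𝓘(ℝ, F) 𝓘(ℝ, F).tangent ∞ (T% (U j)) (ι p) := fun j ↦
    contMDiffAt_localFrame_of_mem (I := 𝓘(ℝ, F)) (n := ∞) e b j
      (FiberBundle.mem_baseSet_trivializationAt' (ι p))
  let a : Fin (finrank ℝ F) → M → ℝ := fun j q ↦ b.coord j (principalPart ι V p q)
  have ha : ∀ j, ContMDiffAt 𝓘(ℝ, E) 𝓘(ℝ, ℝ) ∞ (a j) p := fun j ↦
    ((LinearMap.toContinuousLinearMap (b.coord j)).contDiff.contMDiff.contMDiffAt).comp p hV'.2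
  -- Smoothness of the partial sums is carried along with `P`, because the hypothesis `add` asks for
  -- it.
  have key : ∀ s : Finset (Fin (finrank ℝ F)),
      SmoothAlongAt (E := E) ι (fun q ↦ ∑ j ∈ s, a j q • U j (ι q)) p ∧
        P (fun q ↦ ∑ j ∈ s, a j q • U j (ι q)) := by
    intro s
    induction s using Finset.induction_on with
    | empty =>
      have h0 : ContMDiffAt 𝓘(ℝ, F) 𝓘(ℝ, F).tangent ∞
          (T% (0 : Π x : N, TangentSpace 𝓘(ℝ, F) x)) (ι p) :=
        contMDiff_zeroSection ℝ (fun x : N ↦ TangentSpace 𝓘(ℝ, F) x) |>.contMDiffAt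
      simp only [Finset.sum_empty]
      exact ⟨SmoothAlongAt.comp hV'.1 h0, comp 0 h0⟩
    | insert j s hj ih =>
      simp only [Finset.sum_insert hj]
      have h1 := SmoothAlongAt.comp hV'.1 (hU j)
      exact ⟨(SmoothAlongAt.smul (ha j) h1).add ih.1,
        add _ _ (SmoothAlongAt.smul (ha j) h1) ih.1 (smul _ _ (ha j) h1 (comp _ (hU j))) ih.2⟩
  refine congr _ _ ?_ (key Finset.univ).2
  filter_upwards [eventually_mem_baseSet (F := F) (N := N) hV'.1.continuousAt] with q hq
  have hUq : ∀ j, U j (ι q) = e.basisAt b hq j := fun j ↦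
    e.localFrame_apply_of_mem_baseSet b hq
  simp only [hUq]
  exact (e.basisAt b hq).sum_repr (V q)

lemma SmoothAlongAt.base (hV : SmoothAlongAt (E := E) ι V p) :
    ContMDiffAt 𝓘(ℝ, E) 𝓘(ℝ, F) ∞ ι p := (smoothAlongAt_iff.1 hV).1

lemma SmoothAlongAt.J {J : Π x : N, TangentSpace 𝓘(ℝ, F) x →L[ℝ] TangentSpace 𝓘(ℝ, F) x}
    (hJ : IsKaehler J) (hV : SmoothAlongAt (E := E) ι V p) :
    SmoothAlongAt (E := E) ι (fun q ↦ J (ι q) (V q)) p :=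
  ContMDiffAt.clm_bundle_apply (E₁ := fun x : N ↦ TangentSpace 𝓘(ℝ, F) x)
    (E₂ := fun x : N ↦ TangentSpace 𝓘(ℝ, F) x) (F₁ := F) (F₂ := F)
    (hJ.smooth.contMDiffAt.comp p hV.base) hV

lemma SmoothAlongAt.inner (hV : SmoothAlongAt (E := E) ι V p)
    (hV' : SmoothAlongAt (E := E) ι V' p) :
    ContMDiffAt 𝓘(ℝ, E) 𝓘(ℝ, ℝ) ∞ (fun q ↦ (inner ℝ (V q) (V' q) : ℝ)) p :=
  contMDiffAt_inner hV hV'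

/-- `∇̃ J = 0` along `ι`. -/
theorem covAlong_J {J : Π x : N, TangentSpace 𝓘(ℝ, F) x →L[ℝ] TangentSpace 𝓘(ℝ, F) x}
    (hJ : IsKaehler J) (hV : SmoothAlongAt (E := E) ι V p) (v : TangentSpace 𝓘(ℝ, E) p) :
    covAlong ι (fun q ↦ J (ι q) (V q)) p v = J (ι p) (covAlong ι V p v) := by
  have hι := hV.base.mdifferentiableAt (by simp)
  refine SmoothAlongAt.induction (P := fun V ↦
    covAlong ι (fun q ↦ J (ι q) (V q)) p v = J (ι p) (covAlong ι V p v)) ?_ ?_ ?_ ?_ hV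
  · intro V V' h hP
    rw [← covAlong_congr h, ← hP]
    exact (covAlong_congr (h.mono fun q hq ↦ by rw [hq]) v).symm
  · intro V V' hV hV' hP hP'
    simp only [map_add]
    rw [covAlong_add (hV.J hJ).diff (hV'.J hJ).diff, covAlong_add hV.diff hV'.diff, hP, hP',
      map_add]
  · intro a V ha hV hP
    have ha' := ha.mdifferentiableAt (by simp)
    simp only [map_smul]
    rw [covAlong_smul ha' (hV.J hJ).diff, covAlong_smul ha' hV.diff, hP, map_add, map_smul,
      map_smul]
  · intro U hU
    have hU' := hU.mdifferentiableAt (by simp)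
    have hJU : MDiffAt (T% (fun x ↦ J x (U x))) (ι p) :=
      (SmoothAlongAt.J (E := F) (ι := (id : N → N)) (V := U) hJ hU).diff
    rw [covAlong_comp (U := fun x ↦ J x (U x)) hι hJU, covAlong_comp hι hU',
      hJ.parallel U _ hU']

/-- Compatibility of the connection along `ι` with the metric. -/
theorem mvfderiv_inner_along (hV : SmoothAlongAt (E := E) ι V p)
    (hV' : SmoothAlongAt (E := E) ι V' p) (v : TangentSpace 𝓘(ℝ, E) p) :
    mvfderiv 𝓘(ℝ, E) (fun q ↦ (inner ℝ (V q) (V' q) : ℝ)) p v =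
      inner ℝ (covAlong ι V p v) (V' p) + inner ℝ (V p) (covAlong ι V' p v) := by
  have hι := hV.base.mdifferentiableAt (by simp)
  have hd : ∀ V V' : Π p : M, TangentSpace 𝓘(ℝ, F) (ι p), SmoothAlongAt (E := E) ι V p →
      SmoothAlongAt (E := E) ι V' p →
      MDifferentiableAt 𝓘(ℝ, E) 𝓘(ℝ, ℝ) (fun q ↦ (inner ℝ (V q) (V' q) : ℝ)) p :=
    fun V V' h h' ↦ (h.inner h').mdifferentiableAt (by simp)
  refine SmoothAlongAt.induction (P := fun V ↦
    mvfderiv 𝓘(ℝ, E) (fun q ↦ (inner ℝ (V q) (V' q) : ℝ)) p v =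
      inner ℝ (covAlong ι V p v) (V' p) + inner ℝ (V p) (covAlong ι V' p v)) ?_ ?_ ?_ ?_ hV
  · intro V W h hP
    have he : (fun q ↦ (inner ℝ (V q) (V' q) : ℝ)) =ᶠ[𝓝 p]
        fun q ↦ (inner ℝ (W q) (V' q) : ℝ) := h.mono fun q hq ↦ by simp only [hq]
    rw [← covAlong_congr h, ← h.self_of_nhds, ← hP, mvfderiv_congr he]
  · intro V W hV hW hP hP'
    simp only [inner_add_left]
    rw [mvfderiv_fun_add (hd _ _ hV hV') (hd _ _ hW hV'), covAlong_add hV.diff hW.diff,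
      inner_add_left, add_apply, hP, hP']
    ring
  · intro a V ha hV hP
    have ha' := ha.mdifferentiableAt (by simp)
    simp only [real_inner_smul_left]
    rw [mvfderiv_fun_mul ha' (hd _ _ hV hV'), covAlong_smul ha' hV.diff, inner_add_left,
      real_inner_smul_left, real_inner_smul_left, add_apply, smul_apply,
      smul_apply, hP]
    simp only [smul_eq_mul]
    ring
  -- With the first field reduced to a restriction `U ∘ ι`, a second induction reduces the other
  -- one. For two restrictions the claim is metric compatibility on `N` and the chain rule.
  intro U hU
  have hUd := hU.mdifferentiableAt (by simp)
  have hUs := SmoothAlongAt.comp hV.base hU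
  refine SmoothAlongAt.induction (P := fun V' ↦
    mvfderiv 𝓘(ℝ, E) (fun q ↦ (inner ℝ (U (ι q)) (V' q) : ℝ)) p v =
      inner ℝ (covAlong ι (fun q ↦ U (ι q)) p v) (V' p) +
        inner ℝ (U (ι p)) (covAlong ι V' p v)) ?_ ?_ ?_ ?_ hV'
  · intro V W h hP
    have he : (fun q ↦ (inner ℝ (U (ι q)) (V q) : ℝ)) =ᶠ[𝓝 p]
        fun q ↦ (inner ℝ (U (ι q)) (W q) : ℝ) := h.mono fun q hq ↦ by simp only [hq]
    rw [← covAlong_congr h, ← h.self_of_nhds, ← hP, mvfderiv_congr he]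
  · intro V W hV hW hP hP'
    simp only [inner_add_right]
    rw [mvfderiv_fun_add (hd _ _ hUs hV) (hd _ _ hUs hW), covAlong_add hV.diff hW.diff,
      inner_add_right, add_apply, hP, hP']
    ring
  · intro a V ha hV hP
    have ha' := ha.mdifferentiableAt (by simp)
    simp only [real_inner_smul_right]
    rw [mvfderiv_fun_mul ha' (hd _ _ hUs hV), covAlong_smul ha' hV.diff, inner_add_right,
      real_inner_smul_right, real_inner_smul_right, add_apply, smul_apply,
      smul_apply, hP]
    simp only [smul_eq_mul]
    ring
  · intro U' hU'
    have hUd' := hU'.mdifferentiableAt (by simp)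
    rw [covAlong_comp hι hUd, covAlong_comp hι hUd', ← leviCivita_metric hUd hUd']
    exact mvfderiv_vector_comp (mdiffAt_metric hUd hUd') hι v

/-- The covariant derivative of a smooth field along `ι` in a smooth direction is smooth, in the
weak sense of its inner products. -/
theorem contMDiffAt_inner_covAlong {X : Π x : M, TangentSpace 𝓘(ℝ, E) x}
    (hX : ContMDiffAt 𝓘(ℝ, E) 𝓘(ℝ, E).tangent ∞ (T% X) p)
    (hV : SmoothAlongAt (E := E) ι V p) (hV' : SmoothAlongAt (E := E) ι V' p) :
    ContMDiffAt 𝓘(ℝ, E) 𝓘(ℝ, ℝ) ∞ (fun q ↦ (inner ℝ (covAlong ι V q (X q)) (V' q) : ℝ)) p := by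
  have hι := hV.base
  refine SmoothAlongAt.induction (P := fun V ↦
    ContMDiffAt 𝓘(ℝ, E) 𝓘(ℝ, ℝ) ∞ (fun q ↦ (inner ℝ (covAlong ι V q (X q)) (V' q) : ℝ)) p)
    ?_ ?_ ?_ ?_ hV
  · intro V W h hP
    refine hP.congr_of_eventuallyEq ?_
    filter_upwards [h.eventually_nhds] with q hq
    rw [covAlong_congr hq]
  · intro V W hV hW hP hP'
    refine (hP.add hP').congr_of_eventuallyEq ?_
    filter_upwards [hV.eventually, hW.eventually] with q h1 h2
    rw [covAlong_add h1 h2, inner_add_left]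
    rfl
  · intro a V ha hV hP
    refine ((ha.mul hP).add ((contMDiffAt_mvfderiv_apply ha hX).mul
      (hV.inner hV'))).congr_of_eventuallyEq ?_
    filter_upwards [hV.eventually, (contMDiffAt_iff_contMDiffAt_nhds (n := 1) (by simp)).1
      (ha.of_le (by simp))] with q h1 h2
    rw [covAlong_smul (h2.mdifferentiableAt (by simp)) h1, inner_add_left, real_inner_smul_left,
      real_inner_smul_left]
    rfl
  intro U hU
  -- The direction `dι(X)` is itself a smooth field along `ι`, and the connection is linear in it. A
  -- second induction, now on the direction, leads to smoothness of `∇_{U'} U` on `N`.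
  have h1 : ContMDiffAt 𝓘(ℝ, E) 𝓘(ℝ, ℝ) ∞ (fun q ↦ (inner ℝ (leviCivita F N U (ι q)
      (mfderiv 𝓘(ℝ, E) 𝓘(ℝ, F) ι q (X q))) (V' q) : ℝ)) p := by
    refine SmoothAlongAt.induction (P := fun A ↦ ContMDiffAt 𝓘(ℝ, E) 𝓘(ℝ, ℝ) ∞
      (fun q ↦ (inner ℝ (leviCivita F N U (ι q) (A q)) (V' q) : ℝ)) p) ?_ ?_ ?_ ?_
      (contMDiffAt_mfderiv_apply hι hX)
    · intro V W h hP
      exact hP.congr_of_eventuallyEq (h.mono fun q hq ↦ by simp only [hq])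
    · intro V W hV hW hP hP'
      simp only [map_add, inner_add_left]
      exact hP.add hP'
    · intro a V ha hV hP
      simp only [map_smul, real_inner_smul_left]
      exact ha.mul hP
    · intro U' hU'
      exact SmoothAlongAt.inner (SmoothAlongAt.comp hι (contMDiffAt_leviCivita hU' hU)) hV'
  refine h1.congr_of_eventuallyEq ?_
  filter_upwards [hι.continuousAt.eventually (eventually_mdiffAt hU),
    (contMDiffAt_iff_contMDiffAt_nhds (n := 1) (by simp)).1 (hι.of_le (by simp))] with q h2 h3
  rw [covAlong_comp (h3.mdifferentiableAt (by simp)) h2]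

end AlongInduction

/-! ### Torsion freeness along `ι` and the tangential Gauss formula -/

section Gauss

variable {E : Type*} [NormedAddCommGroup E] [NormedSpace ℝ E] [FiniteDimensional ℝ E]
  [CompleteSpace E]
  {M : Type*} [TopologicalSpace M] [ChartedSpace E M] [IsManifold 𝓘(ℝ, E) ∞ M]
  [RiemannianBundle (fun x : M ↦ TangentSpace 𝓘(ℝ, E) x)]
  [IsContMDiffRiemannianBundle 𝓘(ℝ, E) ∞ E (fun x : M ↦ TangentSpace 𝓘(ℝ, E) x)]
  {F : Type*} [NormedAddCommGroup F] [NormedSpace ℝ F] [FiniteDimensional ℝ F]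
  [CompleteSpace F]
  {N : Type*} [TopologicalSpace N] [ChartedSpace F N] [IsManifold 𝓘(ℝ, F) ∞ N]
  [RiemannianBundle (fun x : N ↦ TangentSpace 𝓘(ℝ, F) x)]
  [IsContMDiffRiemannianBundle 𝓘(ℝ, F) ∞ F (fun x : N ↦ TangentSpace 𝓘(ℝ, F) x)]
-- The tangent bundle is trivialized by differentials of charts. Hence the principal part of `dι(V)`
-- is the derivative along `V` of `ι` read in a chart, to which the commutator formula applies.
lemma trivialization_snd_eq {x y : N} (hy : y ∈ (chartAt F x).source)
    (w : TangentSpace 𝓘(ℝ, F) y) :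
    (trivializationAt F (fun x : N ↦ TangentSpace 𝓘(ℝ, F) x) x ⟨y, w⟩).2 =
      mvfderiv 𝓘(ℝ, F) (extChartAt 𝓘(ℝ, F) x) y w := by
  have h := TangentBundle.continuousLinearMapAt_trivializationAt (I := 𝓘(ℝ, F)) hy
  have h2 := congrArg (fun f ↦ f w) h
  refine Eq.trans ?_ h2
  have hb : y ∈ (trivializationAt F (fun x : N ↦ TangentSpace 𝓘(ℝ, F) x) x).baseSet := by
    simpa using hy
  rw [Trivialization.continuousLinearMapAt_apply, Trivialization.linearMapAt_apply, if_pos hb]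

/-- Fields with constant components in a chart commute: in the commutator formula applied to the
chart map, both iterated derivatives vanish. -/
lemma mlieBracket_extend {x : N} (v w : TangentSpace 𝓘(ℝ, F) x) :
    mlieBracket 𝓘(ℝ, F) (FiberBundle.extend F v) (FiberBundle.extend F w) x = 0 := by
  have hc : ∀ v : TangentSpace 𝓘(ℝ, F) x, (fun y ↦ mvfderiv 𝓘(ℝ, F) (extChartAt 𝓘(ℝ, F) x) y
      (FiberBundle.extend F v y)) =ᶠ[𝓝 x]
      fun _ ↦ (trivializationAt F (fun x : N ↦ TangentSpace 𝓘(ℝ, F) x) x ⟨x, v⟩).2 := by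
    intro v
    filter_upwards [chart_source_mem_nhds F x] with y hy
    rw [← trivialization_snd_eq hy]
    have hb : y ∈ (trivializationAt F (fun x : N ↦ TangentSpace 𝓘(ℝ, F) x) x).baseSet := by
      simpa using hy
    have ha := Trivialization.apply_mk_symm _ hb
      (trivializationAt F (fun x : N ↦ TangentSpace 𝓘(ℝ, F) x) x ⟨x, v⟩).2
    have hs := congrArg Prod.snd ha
    exact hs
  have h := mvfderiv_commutator (contMDiffAt_extChartAt (I := 𝓘(ℝ, F)) (n := ∞) (x := x))
    (FiberBundle.mdifferentiableAt_extend 𝓘(ℝ, F) F v)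
    (FiberBundle.mdifferentiableAt_extend 𝓘(ℝ, F) F w)
  rw [mvfderiv_congr (hc v), mvfderiv_congr (hc w), mvfderiv_const, mvfderiv_const] at h
  have hi : ∀ u : TangentSpace 𝓘(ℝ, F) x, mvfderiv 𝓘(ℝ, F) (extChartAt 𝓘(ℝ, F) x) x u = u := by
    intro u
    change mfderiv 𝓘(ℝ, F) 𝓘(ℝ, F) (extChartAt 𝓘(ℝ, F) x) x u = u
    rw [mfderiv_extChartAt_self]
    rfl
  rw [hi] at h
  exact h.symm.trans (sub_self 0)

variable {ι : M → N} {p : M} {X Y Z : Π x : M, TangentSpace 𝓘(ℝ, E) x}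

/-- The connection along `ι` is torsion free. -/
theorem covAlong_torsion (hι : ContMDiffAt 𝓘(ℝ, E) 𝓘(ℝ, F) ∞ ι p)
    (hX : ContMDiffAt 𝓘(ℝ, E) 𝓘(ℝ, E).tangent ∞ (T% X) p)
    (hY : ContMDiffAt 𝓘(ℝ, E) 𝓘(ℝ, E).tangent ∞ (T% Y) p) :
    covAlong ι (fun q ↦ mfderiv 𝓘(ℝ, E) 𝓘(ℝ, F) ι q (Y q)) p (X p)
      - covAlong ι (fun q ↦ mfderiv 𝓘(ℝ, E) 𝓘(ℝ, F) ι q (X q)) p (Y p)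
      = mfderiv 𝓘(ℝ, E) 𝓘(ℝ, F) ι p (mlieBracket 𝓘(ℝ, E) X Y p) := by
  let t := trivializationAt F (fun x : N ↦ TangentSpace 𝓘(ℝ, F) x) (ι p)
  let φ := extChartAt 𝓘(ℝ, F) (ι p)
  have hb := FiberBundle.mem_baseSet_trivializationAt' (E := fun x : N ↦ TangentSpace 𝓘(ℝ, F) x)
    (F := F) (ι p)
  have hφ : ContMDiffAt 𝓘(ℝ, E) 𝓘(ℝ, F) ∞ (φ ∘ ι) p := contMDiffAt_extChartAt.comp p hι
  have hpp : ∀ V : Π x : M, TangentSpace 𝓘(ℝ, E) x,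
      principalPart ι (fun q ↦ mfderiv 𝓘(ℝ, E) 𝓘(ℝ, F) ι q (V q)) p =ᶠ[𝓝 p]
        fun q ↦ mvfderiv 𝓘(ℝ, E) (φ ∘ ι) q (V q) := by
    intro V
    filter_upwards [hι.continuousAt.eventually (chart_source_mem_nhds F (ι p)),
      (contMDiffAt_iff_contMDiffAt_nhds (n := 1) (by simp)).1 (hι.of_le (by simp))] with q hq hq'
    refine (trivialization_snd_eq hq _).trans ?_
    exact (mvfderiv_vector_comp (mdifferentiableAt_extChartAt hq)
      (hq'.mdifferentiableAt (by simp)) (V q)).symm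
  have hcomm := mvfderiv_commutator hφ (hX.mdifferentiableAt (by simp))
    (hY.mdifferentiableAt (by simp))
  -- The Christoffel term is symmetric, since the extended fields commute at `ι p` and the
  -- connection of `N` is torsion free. Only the principal parts then contribute to the torsion.
  have htor : ∀ v w : TangentSpace 𝓘(ℝ, F) (ι p),
      leviCivita F N (FiberBundle.extend F w) (ι p) v =
        leviCivita F N (FiberBundle.extend F v) (ι p) w := by
    intro v w
    have h := (CovariantDerivative.torsion_eq_zero_iff _).1 (leviCivita_torsion (E := F) (M := N))
      (FiberBundle.mdifferentiableAt_extend 𝓘(ℝ, F) F v)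
      (FiberBundle.mdifferentiableAt_extend 𝓘(ℝ, F) F w)
    rw [mlieBracket_extend, sub_eq_zero] at h
    simpa using h
  rw [covAlong_eq, covAlong_eq, htor, mvfderiv_congr (hpp X), mvfderiv_congr (hpp Y),
    add_sub_add_right_eq_sub]
  have hsub : ∀ a b : F, t.symm (ι p) a - t.symm (ι p) b = t.symm (ι p) (a - b) := by
    intro a b
    have h := fun w ↦ Trivialization.symmₗ_apply (R := ℝ) t hb w
    rw [← h, ← h, ← h, map_sub]
  refine (hsub _ _).trans ?_
  rw [hcomm, mvfderiv_vector_comp (mdifferentiableAt_extChartAt (mem_chart_source F (ι p)))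
    (hι.mdifferentiableAt (by simp)), ← trivialization_snd_eq (mem_chart_source F (ι p))]
  exact t.symm_apply_apply_mk hb _

/-- Gauss formula, tangential part: `g(∇̃_X Y, Z) = g(∇_X Y, Z)`. -/
theorem inner_covAlong_mfderiv (hι : IsIsometricImmersion E F ι)
    (hX : ContMDiffAt 𝓘(ℝ, E) 𝓘(ℝ, E).tangent ∞ (T% X) p)
    (hY : ContMDiffAt 𝓘(ℝ, E) 𝓘(ℝ, E).tangent ∞ (T% Y) p)
    (hZ : ContMDiffAt 𝓘(ℝ, E) 𝓘(ℝ, E).tangent ∞ (T% Z) p) :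
    inner ℝ (covAlong ι (fun q ↦ mfderiv 𝓘(ℝ, E) 𝓘(ℝ, F) ι q (Y q)) p (X p))
      (mfderiv 𝓘(ℝ, E) 𝓘(ℝ, F) ι p (Z p)) = inner ℝ (leviCivita E M Y p (X p)) (Z p) := by
  have hs := hι.smooth p
  -- The uniqueness argument for the Levi-Civita connection: `hm` (metric) and `ht` (torsion free)
  -- are substituted into the Koszul expression, which collapses to twice the left-hand side.
  have hm : ∀ {A B : Π x : M, TangentSpace 𝓘(ℝ, E) x},
      ContMDiffAt 𝓘(ℝ, E) 𝓘(ℝ, E).tangent ∞ (T% A) p →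
      ContMDiffAt 𝓘(ℝ, E) 𝓘(ℝ, E).tangent ∞ (T% B) p → ∀ v : TangentSpace 𝓘(ℝ, E) p,
      mvfderiv 𝓘(ℝ, E) (metric A B) p v =
        inner ℝ (covAlong ι (fun q ↦ mfderiv 𝓘(ℝ, E) 𝓘(ℝ, F) ι q (A q)) p v)
          (mfderiv 𝓘(ℝ, E) 𝓘(ℝ, F) ι p (B p)) +
        inner ℝ (mfderiv 𝓘(ℝ, E) 𝓘(ℝ, F) ι p (A p))
          (covAlong ι (fun q ↦ mfderiv 𝓘(ℝ, E) 𝓘(ℝ, F) ι q (B q)) p v) := by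
    intro A B hA hB v
    rw [← mvfderiv_inner_along (contMDiffAt_mfderiv_apply hs hA) (contMDiffAt_mfderiv_apply hs hB)]
    congr 2
    funext q
    exact (hι.isometric q _ _).symm
  have ht : ∀ {A B C : Π x : M, TangentSpace 𝓘(ℝ, E) x},
      ContMDiffAt 𝓘(ℝ, E) 𝓘(ℝ, E).tangent ∞ (T% A) p →
      ContMDiffAt 𝓘(ℝ, E) 𝓘(ℝ, E).tangent ∞ (T% B) p →
      inner ℝ (mfderiv 𝓘(ℝ, E) 𝓘(ℝ, F) ι p (C p))
        (covAlong ι (fun q ↦ mfderiv 𝓘(ℝ, E) 𝓘(ℝ, F) ι q (B q)) p (A p)) -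
      inner ℝ (mfderiv 𝓘(ℝ, E) 𝓘(ℝ, F) ι p (C p))
        (covAlong ι (fun q ↦ mfderiv 𝓘(ℝ, E) 𝓘(ℝ, F) ι q (A q)) p (B p)) =
      inner ℝ (C p) (mlieBracket 𝓘(ℝ, E) A B p) := by
    intro A B C hA hB
    rw [← inner_sub_right, covAlong_torsion hs hA hB, hι.isometric]
  have hk : inner ℝ (leviCivita E M Y p (X p)) (Z p) = 1 / 2 * koszul Y X Z p :=
    inner_leviCivitaFun (hX.mdifferentiableAt (by simp)) (hY.mdifferentiableAt (by simp))
      (hZ.mdifferentiableAt (by simp))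
  rw [hk, koszul, hm hY hZ, hm hZ hX, hm hX hY, ← ht (C := Y) hX hZ, ← ht (C := Z) hY hX,
    ← ht (C := X) hZ hY]
  simp only [real_inner_comm (mfderiv 𝓘(ℝ, E) 𝓘(ℝ, F) ι p (X p)),
    real_inner_comm (mfderiv 𝓘(ℝ, E) 𝓘(ℝ, F) ι p (Y p)),
    real_inner_comm (mfderiv 𝓘(ℝ, E) 𝓘(ℝ, F) ι p (Z p))]
  ring

end Gauss

/-! ### Normal projection, Gauss formula, and the second fundamental form as a tensor -/

section NormalBundle

variable {E : Type*} [NormedAddCommGroup E] [NormedSpace ℝ E] [FiniteDimensional ℝ E]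
  [CompleteSpace E]
  {M : Type*} [TopologicalSpace M] [ChartedSpace E M] [IsManifold 𝓘(ℝ, E) ∞ M]
  [RiemannianBundle (fun x : M ↦ TangentSpace 𝓘(ℝ, E) x)]
  [IsContMDiffRiemannianBundle 𝓘(ℝ, E) ∞ E (fun x : M ↦ TangentSpace 𝓘(ℝ, E) x)]
  {F : Type*} [NormedAddCommGroup F] [NormedSpace ℝ F] [FiniteDimensional ℝ F]
  [CompleteSpace F]
  {N : Type*} [TopologicalSpace N] [ChartedSpace F N] [IsManifold 𝓘(ℝ, F) ∞ N]
  [RiemannianBundle (fun x : N ↦ TangentSpace 𝓘(ℝ, F) x)]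
  [IsContMDiffRiemannianBundle 𝓘(ℝ, F) ∞ F (fun x : N ↦ TangentSpace 𝓘(ℝ, F) x)]
variable {ι : M → N} {p : M} {X Y Z : Π x : M, TangentSpace 𝓘(ℝ, E) x}
  {J : Π x : N, TangentSpace 𝓘(ℝ, F) x →L[ℝ] TangentSpace 𝓘(ℝ, F) x}

lemma IsKaehler.inner_left (hJ : IsKaehler J) {x : N} (v w : TangentSpace 𝓘(ℝ, F) x) :
    (inner ℝ (J x v) w : ℝ) = -inner ℝ v (J x w) := by
  rw [← hJ.isometric x v (J x w), hJ.sq, inner_neg_right, neg_neg]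

lemma mfderiv_mem_tangentImage (v : TangentSpace 𝓘(ℝ, E) p) :
    (mfderiv 𝓘(ℝ, E) 𝓘(ℝ, F) ι p v : TangentSpace 𝓘(ℝ, F) (ι p)) ∈ tangentImage E ι p :=
  ⟨v, rfl⟩

lemma normalPart_mem (v : TangentSpace 𝓘(ℝ, F) (ι p)) :
    normalPart E ι p v ∈ (tangentImage E ι p)ᗮ :=
  Submodule.starProjection_apply_mem _ _

lemma normalPart_of_mem {v : TangentSpace 𝓘(ℝ, F) (ι p)} (hv : v ∈ tangentImage E ι p) :
    normalPart E ι p v = 0 := by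
  rw [normalPart, Submodule.starProjection_apply_eq_zero_iff]
  exact Submodule.le_orthogonal_orthogonal _ hv

lemma normalPart_of_mem_orthogonal {v : TangentSpace 𝓘(ℝ, F) (ι p)}
    (hv : v ∈ (tangentImage E ι p)ᗮ) : normalPart E ι p v = v :=
  Submodule.starProjection_eq_self_iff.2 hv

lemma mem_tangentImage_of_normalPart {v : TangentSpace 𝓘(ℝ, F) (ι p)}
    (hv : normalPart E ι p v = 0) : v ∈ tangentImage E ι p := by
  rw [normalPart, Submodule.starProjection_apply_eq_zero_iff,
    Submodule.orthogonal_orthogonal] at hv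
  exact hv

lemma normalPart_add (v w : TangentSpace 𝓘(ℝ, F) (ι p)) :
    normalPart E ι p (v + w) = normalPart E ι p v + normalPart E ι p w := map_add _ v w

lemma normalPart_sub (v w : TangentSpace 𝓘(ℝ, F) (ι p)) :
    normalPart E ι p (v - w) = normalPart E ι p v - normalPart E ι p w := map_sub _ v w

lemma normalPart_smul (a : ℝ) (v : TangentSpace 𝓘(ℝ, F) (ι p)) :
    normalPart E ι p (a • v) = a • normalPart E ι p v := map_smul _ a v

lemma normalPart_zero : normalPart E ι p (0 : TangentSpace 𝓘(ℝ, F) (ι p)) = 0 := map_zero _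

lemma inner_normalPart (v : TangentSpace 𝓘(ℝ, F) (ι p)) {w : TangentSpace 𝓘(ℝ, F) (ι p)}
    (hw : w ∈ (tangentImage E ι p)ᗮ) : (inner ℝ (normalPart E ι p v) w : ℝ) = inner ℝ v w := by
  rw [normalPart, Submodule.inner_starProjection_left_eq_right,
    Submodule.starProjection_eq_self_iff.2 hw]

/-- The Gauss formula `∇̃_X Y = ∇_X Y + σ(X, Y)`. -/
theorem covAlong_mfderiv_eq (hι : IsIsometricImmersion E F ι)
    (hX : ContMDiffAt 𝓘(ℝ, E) 𝓘(ℝ, E).tangent ∞ (T% X) p)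
    (hY : ContMDiffAt 𝓘(ℝ, E) 𝓘(ℝ, E).tangent ∞ (T% Y) p) :
    covAlong ι (fun q ↦ mfderiv 𝓘(ℝ, E) 𝓘(ℝ, F) ι q (Y q)) p (X p) =
      mfderiv 𝓘(ℝ, E) 𝓘(ℝ, F) ι p (leviCivita E M Y p (X p)) +
        secondFundamentalForm ι X Y p := by
  set A := covAlong ι (fun q ↦ mfderiv 𝓘(ℝ, E) 𝓘(ℝ, F) ι q (Y q)) p (X p) with hA
  set B : TangentSpace 𝓘(ℝ, F) (ι p) :=
    mfderiv 𝓘(ℝ, E) 𝓘(ℝ, F) ι p (leviCivita E M Y p (X p)) with hB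
  have hperp : A - B ∈ (tangentImage E ι p)ᗮ := by
    rw [Submodule.mem_orthogonal']
    rintro _ ⟨w, rfl⟩
    have hw := FiberBundle.contMDiffAt_extend 𝓘(ℝ, E) E w (k := ∞)
    have h := inner_covAlong_mfderiv hι hX hY hw
    rw [FiberBundle.extend_apply_self] at h
    rw [inner_sub_left, sub_eq_zero]
    refine h.trans ?_
    exact (hι.isometric p _ _).symm
  have h : secondFundamentalForm ι X Y p = A - B := by
    change normalPart E ι p A = A - B
    rw [← normalPart_of_mem_orthogonal hperp, normalPart_sub,
      normalPart_of_mem (mfderiv_mem_tangentImage _), sub_zero]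
  rw [h]
  abel

/-- The antisymmetric part is the normal component of `dι[X,Y]`, which is tangent. -/
lemma secondFundamentalForm_symm (hι : IsIsometricImmersion E F ι)
    (hX : ContMDiffAt 𝓘(ℝ, E) 𝓘(ℝ, E).tangent ∞ (T% X) p)
    (hY : ContMDiffAt 𝓘(ℝ, E) 𝓘(ℝ, E).tangent ∞ (T% Y) p) :
    (secondFundamentalForm ι X Y p : TangentSpace 𝓘(ℝ, F) (ι p)) =
      secondFundamentalForm ι Y X p := by
  have h := covAlong_torsion (hι.smooth p) hX hY
  rw [← sub_eq_zero]
  change normalPart E ι p _ - normalPart E ι p _ = 0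
  rw [← normalPart_sub, h]
  exact normalPart_of_mem (mfderiv_mem_tangentImage _)

lemma secondFundamentalForm_congr_left {X' : Π x : M, TangentSpace 𝓘(ℝ, E) x} (h : X p = X' p) :
    (secondFundamentalForm ι X Y p : TangentSpace 𝓘(ℝ, F) (ι p)) =
      secondFundamentalForm ι X' Y p := by
  rw [secondFundamentalForm, secondFundamentalForm, h]

variable (E) in
/-- The second fundamental form at `p` on tangent vectors. -/
def sff (ι : M → N) (p : M) (v w : TangentSpace 𝓘(ℝ, E) p) : TangentSpace 𝓘(ℝ, F) (ι p) :=
  secondFundamentalForm ι (FiberBundle.extend E v) (FiberBundle.extend E w) p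

/-- Dependence on the first field is pointwise by definition; symmetry transfers this to the second.
-/
lemma secondFundamentalForm_eq_sff (hι : IsIsometricImmersion E F ι)
    (hY : ContMDiffAt 𝓘(ℝ, E) 𝓘(ℝ, E).tangent ∞ (T% Y) p) :
    (secondFundamentalForm ι X Y p : TangentSpace 𝓘(ℝ, F) (ι p)) = sff E ι p (X p) (Y p) := by
  have hx := FiberBundle.contMDiffAt_extend 𝓘(ℝ, E) E (X p) (k := ∞)
  have hy := FiberBundle.contMDiffAt_extend 𝓘(ℝ, E) E (Y p) (k := ∞)
  rw [secondFundamentalForm_congr_left (X' := FiberBundle.extend E (X p)) (by simp),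
    secondFundamentalForm_symm hι hx hY,
    secondFundamentalForm_congr_left (X' := FiberBundle.extend E (Y p)) (by simp),
    secondFundamentalForm_symm hι hy hx]
  rfl

lemma sff_symm (hι : IsIsometricImmersion E F ι) (v w : TangentSpace 𝓘(ℝ, E) p) :
    (sff E ι p v w : TangentSpace 𝓘(ℝ, F) (ι p)) = sff E ι p w v :=
  secondFundamentalForm_symm hι (FiberBundle.contMDiffAt_extend 𝓘(ℝ, E) E v)
    (FiberBundle.contMDiffAt_extend 𝓘(ℝ, E) E w)

lemma covAlong_vector_add {V : Π p : M, TangentSpace 𝓘(ℝ, F) (ι p)}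
    (v w : TangentSpace 𝓘(ℝ, E) p) :
    covAlong ι V p (v + w) = covAlong ι V p v + covAlong ι V p w := by
  have hb := FiberBundle.mem_baseSet_trivializationAt' (E := fun x : N ↦ TangentSpace 𝓘(ℝ, F) x)
    (F := F) (ι p)
  rw [covAlong_eq, covAlong_eq, covAlong_eq, map_add, map_add, map_add, symm_add hb]
  exact add_add_add_comm _ _ _ _

lemma covAlong_vector_smul {V : Π p : M, TangentSpace 𝓘(ℝ, F) (ι p)}
    (a : ℝ) (v : TangentSpace 𝓘(ℝ, E) p) :
    covAlong ι V p (a • v) = a • covAlong ι V p v := by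
  have hb := FiberBundle.mem_baseSet_trivializationAt' (E := fun x : N ↦ TangentSpace 𝓘(ℝ, F) x)
    (F := F) (ι p)
  rw [covAlong_eq, covAlong_eq, map_smul, map_smul, map_smul, symm_smul hb]
  exact (smul_add _ _ _).symm

lemma sff_add_left (v v' w : TangentSpace 𝓘(ℝ, E) p) :
    (sff E ι p (v + v') w : TangentSpace 𝓘(ℝ, F) (ι p)) = sff E ι p v w + sff E ι p v' w := by
  simp only [sff, secondFundamentalForm, FiberBundle.extend_apply_self]
  rw [covAlong_vector_add, normalPart_add]

lemma sff_smul_left (a : ℝ) (v w : TangentSpace 𝓘(ℝ, E) p) :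
    (sff E ι p (a • v) w : TangentSpace 𝓘(ℝ, F) (ι p)) = a • sff E ι p v w := by
  simp only [sff, secondFundamentalForm, FiberBundle.extend_apply_self]
  rw [covAlong_vector_smul, normalPart_smul]

/-- The second fundamental form at `p` as a bilinear map. -/
def sffBilin (hι : IsIsometricImmersion E F ι) (p : M) :
    TangentSpace 𝓘(ℝ, E) p →ₗ[ℝ] TangentSpace 𝓘(ℝ, E) p →ₗ[ℝ] TangentSpace 𝓘(ℝ, F) (ι p) :=
  LinearMap.mk₂ ℝ (sff E ι p) sff_add_left sff_smul_left
    (fun v w w' ↦ by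
      rw [sff_symm hι, sff_add_left, sff_symm hι w, sff_symm hι w'])
    (fun a v w ↦ by rw [sff_symm hι, sff_smul_left, sff_symm hι w])

/-- The trace of a bilinear map does not depend on the orthonormal basis. -/
lemma sum_bilin_orthonormalBasis {κ κ' A B : Type*} [Fintype κ] [Fintype κ']
    [NormedAddCommGroup A] [InnerProductSpace ℝ A] [AddCommGroup B] [Module ℝ B]
    (β : A →ₗ[ℝ] A →ₗ[ℝ] B) (b : OrthonormalBasis κ ℝ A) (b' : OrthonormalBasis κ' ℝ A) :
    ∑ i, β (b i) (b i) = ∑ j, β (b' j) (b' j) := by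
  calc ∑ i, β (b i) (b i) = ∑ i, ∑ j, (inner ℝ (b' j) (b i) : ℝ) • β (b' j) (b i) := by
        refine Finset.sum_congr rfl fun i _ ↦ ?_
        conv_lhs => rw [show β (b i) (b i) = β (∑ j, (inner ℝ (b' j) (b i) : ℝ) • b' j) (b i) by
          rw [b'.sum_repr' (b i)]]
        simp
    _ = ∑ j, ∑ i, (inner ℝ (b' j) (b i) : ℝ) • β (b' j) (b i) := Finset.sum_comm
    _ = ∑ j, β (b' j) (b' j) := by
        refine Finset.sum_congr rfl fun j _ ↦ ?_
        conv_rhs => rw [show β (b' j) (b' j) = β (b' j) (∑ i, (inner ℝ (b i) (b' j) : ℝ) • b i) by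
          rw [b.sum_repr' (b' j)]]
        simp [real_inner_comm]

/-- The mean curvature vector in terms of an arbitrary orthonormal basis. -/
lemma meanCurvature_eq {κ : Type*} [Fintype κ] (hι : IsIsometricImmersion E F ι)
    (b : OrthonormalBasis κ ℝ (TangentSpace 𝓘(ℝ, E) p)) :
    meanCurvature E F ι p = (finrank ℝ E : ℝ)⁻¹ • ∑ i, sff E ι p (b i) (b i) := by
  have h := sum_bilin_orthonormalBasis (sffBilin hι p) (stdOrthonormalBasis ℝ _) b
  exact congrArg _ h

end NormalBundle

/-! ### Totally real submanifolds with parallel `f`-structure -/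

section TotallyRealSubmanifold

variable {E : Type*} [NormedAddCommGroup E] [NormedSpace ℝ E] [FiniteDimensional ℝ E]
  [CompleteSpace E]
  {M : Type*} [TopologicalSpace M] [ChartedSpace E M] [IsManifold 𝓘(ℝ, E) ∞ M]
  [RiemannianBundle (fun x : M ↦ TangentSpace 𝓘(ℝ, E) x)]
  [IsContMDiffRiemannianBundle 𝓘(ℝ, E) ∞ E (fun x : M ↦ TangentSpace 𝓘(ℝ, E) x)]
  {F : Type*} [NormedAddCommGroup F] [NormedSpace ℝ F] [FiniteDimensional ℝ F]
  [CompleteSpace F]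
  {N : Type*} [TopologicalSpace N] [ChartedSpace F N] [IsManifold 𝓘(ℝ, F) ∞ N]
  [RiemannianBundle (fun x : N ↦ TangentSpace 𝓘(ℝ, F) x)]
  [IsContMDiffRiemannianBundle 𝓘(ℝ, F) ∞ F (fun x : N ↦ TangentSpace 𝓘(ℝ, F) x)]
variable {ι : M → N} {p : M} {X Y Z : Π x : M, TangentSpace 𝓘(ℝ, E) x}
  {J : Π x : N, TangentSpace 𝓘(ℝ, F) x →L[ℝ] TangentSpace 𝓘(ℝ, F) x}

/-- The zero field is treated as `0 • V`; the field `V` serves only to supply differentiability. -/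
lemma covAlong_zero {V : Π p : M, TangentSpace 𝓘(ℝ, F) (ι p)}
    (hV : DiffAlongAt (E := E) ι V p) (v : TangentSpace 𝓘(ℝ, E) p) :
    covAlong ι (fun q ↦ (0 : TangentSpace 𝓘(ℝ, F) (ι q))) p v = 0 := by
  have h := covAlong_smul (a := fun _ ↦ (0 : ℝ)) mdifferentiableAt_const hV v
  have h0 : mvfderiv 𝓘(ℝ, E) (fun _ : M ↦ (0 : ℝ)) p = 0 := mvfderiv_const 0
  rw [h0] at h
  simpa using! h

/-- On a totally real submanifold, `J` sends smooth tangent fields to smooth normal fields. -/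
lemma isSmoothNormalField_J (hJ : IsKaehler J) (hι : IsIsometricImmersion E F ι)
    (hreal : IsTotallyReal E ι J) (hY : IsSmoothField Y) :
    IsSmoothNormalField E ι (fun q ↦ J (ι q) (mfderiv 𝓘(ℝ, E) 𝓘(ℝ, F) ι q (Y q))) where
  smooth q := SmoothAlongAt.J hJ (contMDiffAt_mfderiv_apply (hι.smooth q) (hY q))
  normal q := hreal q _ (mfderiv_mem_tangentImage _)

lemma covAlong_J_mfderiv (hJ : IsKaehler J) (hι : IsIsometricImmersion E F ι)
    (hX : IsSmoothField X) (hY : IsSmoothField Y) :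
    covAlong ι (fun q ↦ J (ι q) (mfderiv 𝓘(ℝ, E) 𝓘(ℝ, F) ι q (Y q))) p (X p) =
      J (ι p) (mfderiv 𝓘(ℝ, E) 𝓘(ℝ, F) ι p (leviCivita E M Y p (X p))) +
        J (ι p) (secondFundamentalForm ι X Y p) := by
  rw [covAlong_J hJ (contMDiffAt_mfderiv_apply (hι.smooth p) (hY p)),
    covAlong_mfderiv_eq hι (hX p) (hY p), map_add]

/-- `f` is skew-adjoint on normal vectors because `J` is, so `|fv|² = -g(v, f²v)` and `f²v = 0`
forces `fv = 0`. -/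
lemma normalPart_J_eq_zero (hJ : IsKaehler J) {v : TangentSpace 𝓘(ℝ, F) (ι p)}
    (hv : v ∈ (tangentImage E ι p)ᗮ)
    (h : normalPart E ι p (J (ι p) (normalPart E ι p (J (ι p) v))) = 0) :
    normalPart E ι p (J (ι p) v) = 0 := by
  have h1 : (inner ℝ (normalPart E ι p (J (ι p) v)) (normalPart E ι p (J (ι p) v)) : ℝ) = 0 := by
    have h2 := inner_normalPart (J (ι p) (normalPart E ι p (J (ι p) v))) hv
    rw [h, inner_zero_left, real_inner_comm] at h2
    rw [inner_normalPart _ (normalPart_mem _), hJ.inner_left, ← h2, neg_zero]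
  exact inner_self_eq_zero.1 h1

/-- If the `f`-structure is parallel, then `J σ` is tangent to the submanifold. -/
theorem normalPart_J_secondFundamentalForm (hJ : IsKaehler J) (hι : IsIsometricImmersion E F ι)
    (hreal : IsTotallyReal E ι J) (hf : HasParallelFStructure E ι J)
    (hX : IsSmoothField X) (hY : IsSmoothField Y) :
    normalPart E ι p (J (ι p) (secondFundamentalForm ι X Y p)) = 0 := by
  have h0 : fStructure E ι J (fun q ↦ J (ι q) (mfderiv 𝓘(ℝ, E) 𝓘(ℝ, F) ι q (Y q))) =
      fun q ↦ (0 : TangentSpace 𝓘(ℝ, F) (ι q)) := by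
    funext q
    change normalPart E ι q (J (ι q) (J (ι q) _)) = 0
    rw [hJ.sq]
    exact normalPart_of_mem (neg_mem (mfderiv_mem_tangentImage _))
  -- Since `f(JY) = 0`, parallelism gives `f(D_X(JY)) = 0`. In `D_X(JY) = J∇_X Y + fσ(X,Y)` the
  -- first summand is also killed by `f`, which leaves `f²σ(X,Y) = 0`.
  have h1 := hf X hX _ (isSmoothNormalField_J hJ hι hreal hY) p
  rw [h0, normalCov, covAlong_zero
    (SmoothAlongAt.diff (contMDiffAt_mfderiv_apply (hι.smooth p) (hY p))), normalPart_zero] at h1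
  refine normalPart_J_eq_zero hJ (normalPart_mem _) (Eq.trans ?_ h1.symm)
  rw [fStructure, normalCov, covAlong_J_mfderiv hJ hι hX hY, normalPart_add, map_add,
    normalPart_add, normalPart_of_mem_orthogonal (hreal p _ (mfderiv_mem_tangentImage _)), hJ.sq,
    normalPart_of_mem (neg_mem (mfderiv_mem_tangentImage _)), zero_add]

/-- Of the two terms in `J` of the Gauss formula, `J∇_X Y` is already normal and `Jσ(X,Y)` is
tangent, so the projection keeps exactly the first. -/
lemma normalCov_J_mfderiv (hJ : IsKaehler J) (hι : IsIsometricImmersion E F ι)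
    (hreal : IsTotallyReal E ι J) (hf : HasParallelFStructure E ι J)
    (hX : IsSmoothField X) (hY : IsSmoothField Y) :
    normalCov ι X (fun q ↦ J (ι q) (mfderiv 𝓘(ℝ, E) 𝓘(ℝ, F) ι q (Y q))) p =
      J (ι p) (mfderiv 𝓘(ℝ, E) 𝓘(ℝ, F) ι p (leviCivita E M Y p (X p))) := by
  rw [normalCov, covAlong_J_mfderiv hJ hι hX hY, normalPart_add,
    normalPart_J_secondFundamentalForm hJ hι hreal hf hX hY, add_zero,
    normalPart_of_mem_orthogonal (hreal p _ (mfderiv_mem_tangentImage _))]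

/-- Normal derivatives of `J` of a smooth tangent field are again of that form, so `J ∘ dι` can be
pulled out of every term of the curvature. -/
lemma normalCurvature_J_mfderiv (hJ : IsKaehler J) (hι : IsIsometricImmersion E F ι)
    (hreal : IsTotallyReal E ι J) (hf : HasParallelFStructure E ι J)
    (hX : IsSmoothField X) (hY : IsSmoothField Y) (hZ : IsSmoothField Z) :
    normalCurvature ι X Y (fun q ↦ J (ι q) (mfderiv 𝓘(ℝ, E) 𝓘(ℝ, F) ι q (Z q))) p =
      J (ι p) (mfderiv 𝓘(ℝ, E) 𝓘(ℝ, F) ι p (curvature X Y Z p)) := by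
  have key : ∀ {A B : Π x : M, TangentSpace 𝓘(ℝ, E) x}, IsSmoothField A → IsSmoothField B →
      normalCov ι A (fun q ↦ J (ι q) (mfderiv 𝓘(ℝ, E) 𝓘(ℝ, F) ι q (B q))) =
        fun q ↦ J (ι q) (mfderiv 𝓘(ℝ, E) 𝓘(ℝ, F) ι q (leviCivita E M B q (A q))) :=
    fun hA hB ↦ funext fun q ↦ normalCov_J_mfderiv hJ hι hreal hf hA hB
  have hXZ : IsSmoothField (fun q ↦ leviCivita E M Z q (X q)) :=
    fun q ↦ contMDiffAt_leviCivita (hX q) (hZ q)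
  have hYZ : IsSmoothField (fun q ↦ leviCivita E M Z q (Y q)) :=
    fun q ↦ contMDiffAt_leviCivita (hY q) (hZ q)
  have hXY : IsSmoothField (mlieBracket 𝓘(ℝ, E) X Y) :=
    fun q ↦ contMDiffAt_mlieBracket (hX q) (hY q)
  rw [normalCurvature, key hY hZ, key hX hZ, key hX hYZ, key hY hXZ, key hXY hZ, curvature,
    map_sub, map_sub, map_sub, map_sub]

lemma normalPart_J_meanCurvature [T2Space M] (hJ : IsKaehler J)
    (hι : IsIsometricImmersion E F ι)
    (hreal : IsTotallyReal E ι J) (hf : HasParallelFStructure E ι J) (p : M) :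
    normalPart E ι p (J (ι p) (meanCurvature E F ι p)) = 0 := by
  have hσ : ∀ v w : TangentSpace 𝓘(ℝ, E) p, normalPart E ι p (J (ι p) (sff E ι p v w)) = 0 := by
    intro v w
    obtain ⟨X, hX, rfl, -⟩ := exists_isSmoothField_extend v
    obtain ⟨Y, hY, rfl, -⟩ := exists_isSmoothField_extend w
    rw [← secondFundamentalForm_eq_sff hι (hY p)]
    exact normalPart_J_secondFundamentalForm hJ hι hreal hf hX hY
  rw [meanCurvature_eq hι (stdOrthonormalBasis ℝ (TangentSpace 𝓘(ℝ, E) p)), map_smul,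
    normalPart_smul, map_sum, normalPart, map_sum]
  exact (congrArg _ (Finset.sum_eq_zero fun i _ ↦ hσ _ _)).trans (smul_zero _)

/-- The mean curvature vector is the image under `J` of a smooth tangent field. -/
theorem exists_meanCurvature_eq_J [T2Space M] (hJ : IsKaehler J)
    (hι : IsIsometricImmersion E F ι)
    (hreal : IsTotallyReal E ι J) (hf : HasParallelFStructure E ι J) :
    ∃ Z : Π x : M, TangentSpace 𝓘(ℝ, E) x, IsSmoothField Z ∧
      meanCurvature E F ι = fun q ↦ J (ι q) (mfderiv 𝓘(ℝ, E) 𝓘(ℝ, F) ι q (Z q)) := by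
  -- The witness is `Z = -JH`, tangent because `fH = 0`; then `JZ = H` by `J² = -1`.
  have hex : ∀ q : M, ∃ z : TangentSpace 𝓘(ℝ, E) q,
      (mfderiv 𝓘(ℝ, E) 𝓘(ℝ, F) ι q z : TangentSpace 𝓘(ℝ, F) (ι q)) =
        -J (ι q) (meanCurvature E F ι q) := fun q ↦
    neg_mem (mem_tangentImage_of_normalPart (normalPart_J_meanCurvature hJ hι hreal hf q))
  choose Z hZ using hex
  refine ⟨Z, fun p ↦ contMDiffAt_of_inner fun X hX ↦ ?_, funext fun q ↦ ?_⟩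
  -- The bases in `meanCurvature` are chosen point by point, so they are replaced by a smooth
  -- orthonormal frame. Then `g(X,Z) = g(H,JX)` is the average of `g(∇̃_{s_i} s_i, JX)`: the normal
  -- projection drops out because `JX` is normal, and its smoothness is never needed.
  · obtain ⟨s, hs⟩ := exists_orthonormal_frame (E := E) p
    have hsmooth : ContMDiffAt 𝓘(ℝ, E) 𝓘(ℝ, ℝ) ∞ (fun q ↦ (finrank ℝ E : ℝ)⁻¹ *
        ∑ i, (inner ℝ (covAlong ι (fun q ↦ mfderiv 𝓘(ℝ, E) 𝓘(ℝ, F) ι q (s i q)) q (s i q))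
          (J (ι q) (mfderiv 𝓘(ℝ, E) 𝓘(ℝ, F) ι q (X q))) : ℝ)) p :=
      contMDiffAt_const.mul (ContMDiffAt.sum fun i _ ↦
        contMDiffAt_inner_covAlong (hs.self_of_nhds.1 i)
          (contMDiffAt_mfderiv_apply (hι.smooth p) (hs.self_of_nhds.1 i))
          (SmoothAlongAt.J hJ (contMDiffAt_mfderiv_apply (hι.smooth p) hX)))
    refine hsmooth.congr_of_eventuallyEq ?_
    filter_upwards [hs] with q hq
    obtain ⟨hsq, b, hb⟩ := hq
    have hperp := hreal q _ (mfderiv_mem_tangentImage (ι := ι) (X q))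
    have h1 : (inner ℝ (X q) (Z q) : ℝ) = inner ℝ (meanCurvature E F ι q)
        (J (ι q) (mfderiv 𝓘(ℝ, E) 𝓘(ℝ, F) ι q (X q))) := by
      rw [← hι.isometric q, real_inner_comm]
      refine (congrArg (fun v : TangentSpace 𝓘(ℝ, F) (ι q) ↦ (inner ℝ v
        (mfderiv 𝓘(ℝ, E) 𝓘(ℝ, F) ι q (X q) : TangentSpace 𝓘(ℝ, F) (ι q)) : ℝ)) (hZ q)).trans ?_
      rw [inner_neg_left, hJ.inner_left, neg_neg]
    rw [h1, meanCurvature_eq hι b, real_inner_smul_left, sum_inner]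
    refine congrArg _ (Finset.sum_congr rfl fun i _ ↦ ?_)
    rw [hb i, ← secondFundamentalForm_eq_sff hι (hsq i)]
    exact inner_normalPart _ hperp
  · refine Eq.symm ((congrArg (J (ι q)) (hZ q)).trans ?_)
    rw [map_neg, hJ.sq, neg_neg]

lemma IsIsometricImmersion.mfderiv_injective (hι : IsIsometricImmersion E F ι)
    {v : TangentSpace 𝓘(ℝ, E) p}
    (h : (mfderiv 𝓘(ℝ, E) 𝓘(ℝ, F) ι p v : TangentSpace 𝓘(ℝ, F) (ι p)) = 0) : v = 0 := by
  have h1 := hι.isometric p v v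
  refine inner_self_eq_zero (𝕜 := ℝ).1 (h1.symm.trans ?_)
  refine (congrArg (fun w : TangentSpace 𝓘(ℝ, F) (ι p) ↦ (inner ℝ w w : ℝ)) h).trans ?_
  exact inner_zero_left _

lemma IsKaehler.eq_zero (hJ : IsKaehler J) {x : N} {v : TangentSpace 𝓘(ℝ, F) x}
    (h : J x v = 0) : v = 0 := by
  have h1 := hJ.sq x v
  rw [h, map_zero] at h1
  exact neg_eq_zero.1 h1.symm

/-- A field `Z` with `R(X, Y) Z = 0` for all `X`, `Y` vanishes on a manifold of dimension at
least two and constant nonzero curvature. -/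
lemma eq_zero_of_curvature_eq_zero [T2Space M] {c : ℝ} (hc0 : c ≠ 0)
    (hc : HasConstantCurvature E M c) (hE : 1 < finrank ℝ E) (hZ : IsSmoothField Z)
    (h : ∀ X : Π x : M, TangentSpace 𝓘(ℝ, E) x, IsSmoothField X → curvature X Z Z p = 0) :
    Z p = 0 := by
  obtain ⟨v, hv, hv0⟩ : ∃ v : TangentSpace 𝓘(ℝ, E) p, (inner ℝ v (Z p) : ℝ) = 0 ∧ v ≠ 0 := by
    -- A line cannot fill a space of dimension at least two; this covers the case `Z p = 0` as well.
    have h1 : (Submodule.span ℝ {Z p})ᗮ ≠ ⊥ := by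
      intro h2
      rw [Submodule.orthogonal_eq_bot_iff] at h2
      have h3 := finrank_span_le_card (R := ℝ) ({Z p} : Set (TangentSpace 𝓘(ℝ, E) p))
      rw [h2, finrank_top, Set.toFinset_singleton, Finset.card_singleton] at h3
      exact absurd h3 (not_le.2 hE)
    obtain ⟨v, hv, hv0⟩ := Submodule.exists_mem_ne_zero_of_ne_bot h1
    refine ⟨v, ?_, hv0⟩
    rw [real_inner_comm]
    exact Submodule.mem_orthogonal_singleton_iff_inner_right.1 hv
  obtain ⟨X, hX, rfl, -⟩ := exists_isSmoothField_extend v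
  have h1 := hc X Z hX hZ p
  rw [h X hX, inner_zero_left, hv] at h1
  have h2 : (inner ℝ (X p) (X p) : ℝ) ≠ 0 := fun h3 ↦ hv0 (inner_self_eq_zero.1 h3)
  have h3 : (inner ℝ (Z p) (Z p) : ℝ) = 0 := by
    have h4 : c * (inner ℝ (X p) (X p) * inner ℝ (Z p) (Z p)) = 0 := by
      rw [h1]; ring
    exact (mul_eq_zero.1 ((mul_eq_zero.1 h4).resolve_left hc0)).resolve_left h2
  exact inner_self_eq_zero.1 h3

/-- A totally real submanifold of constant curvature with parallel `f`-structure and semiparallel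
mean curvature vector is minimal or flat. -/
theorem isMinimal_or_isFlat [T2Space M] (hE : 1 < finrank ℝ E) (hJ : IsKaehler J)
    (hι : IsIsometricImmersion E F ι) (hreal : IsTotallyReal E ι J)
    (hf : HasParallelFStructure E ι J) {c : ℝ} (hc : HasConstantCurvature E M c)
    (hH : HasSemiparallelMeanCurvature E F ι) : IsMinimal E F ι ∨ IsFlat E M := by
  by_cases hc0 : c = 0
  · subst hc0
    exact Or.inr hc
  refine Or.inl fun p ↦ ?_
  obtain ⟨Z, hZ, hHZ⟩ := exists_meanCurvature_eq_J hJ hι hreal hf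
  -- Semiparallelity is needed only for the pairs `(X, Z)`, where it says `J(dι(R(X,Z)Z)) = 0`; `J`
  -- and `dι` are injective.
  have hZp : Z p = 0 := eq_zero_of_curvature_eq_zero hc0 hc hE hZ fun X hX ↦ by
    have h := hH X Z hX hZ p
    rw [hHZ, normalCurvature_J_mfderiv hJ hι hreal hf hX hZ hZ] at h
    exact hι.mfderiv_injective (hJ.eq_zero h)
  rw [hHZ]
  change J (ι p) (mfderiv 𝓘(ℝ, E) 𝓘(ℝ, F) ι p (Z p)) = 0
  rw [hZp, map_zero, map_zero]

end TotallyRealSubmanifold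

end TotallyReal

end

theorem proposition1 {n m : ℕ} (hn : 1 < n)
    {M : Type*} [TopologicalSpace M] [T2Space M] [ChartedSpace (EuclideanSpace ℝ (Fin n)) M]
    [IsManifold 𝓘(ℝ, EuclideanSpace ℝ (Fin n)) ∞ M]
    [RiemannianBundle (fun p : M ↦ TangentSpace 𝓘(ℝ, EuclideanSpace ℝ (Fin n)) p)]
    [IsContMDiffRiemannianBundle 𝓘(ℝ, EuclideanSpace ℝ (Fin n)) ∞ (EuclideanSpace ℝ (Fin n))
      (fun p : M ↦ TangentSpace 𝓘(ℝ, EuclideanSpace ℝ (Fin n)) p)]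
    {N : Type*} [TopologicalSpace N] [T2Space N] [ChartedSpace (EuclideanSpace ℝ (Fin (2 * m))) N]
    [IsManifold 𝓘(ℝ, EuclideanSpace ℝ (Fin (2 * m))) ∞ N]
    [RiemannianBundle (fun x : N ↦ TangentSpace 𝓘(ℝ, EuclideanSpace ℝ (Fin (2 * m))) x)]
    [IsContMDiffRiemannianBundle 𝓘(ℝ, EuclideanSpace ℝ (Fin (2 * m))) ∞
      (EuclideanSpace ℝ (Fin (2 * m)))
      (fun x : N ↦ TangentSpace 𝓘(ℝ, EuclideanSpace ℝ (Fin (2 * m))) x)]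
    (J : Π x : N, TangentSpace 𝓘(ℝ, EuclideanSpace ℝ (Fin (2 * m))) x →L[ℝ]
      TangentSpace 𝓘(ℝ, EuclideanSpace ℝ (Fin (2 * m))) x)
    (hJ : TotallyReal.IsKaehler J)
    (ι : M → N)
    (hι : TotallyReal.IsIsometricImmersion (EuclideanSpace ℝ (Fin n))
      (EuclideanSpace ℝ (Fin (2 * m))) ι)
    (hreal : TotallyReal.IsTotallyReal (EuclideanSpace ℝ (Fin n)) ι J)
    (hf : TotallyReal.HasParallelFStructure (EuclideanSpace ℝ (Fin n)) ι J)
    (c : ℝ) (hc : TotallyReal.HasConstantCurvature (EuclideanSpace ℝ (Fin n)) M c)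
    (hH : TotallyReal.HasSemiparallelMeanCurvature (EuclideanSpace ℝ (Fin n))
      (EuclideanSpace ℝ (Fin (2 * m))) ι) :
    TotallyReal.IsMinimal (EuclideanSpace ℝ (Fin n)) (EuclideanSpace ℝ (Fin (2 * m))) ι ∨
      TotallyReal.IsFlat (EuclideanSpace ℝ (Fin n)) M :=
  TotallyReal.isMinimal_or_isFlat (by simpa using hn) hJ hι hreal hf hc hH
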